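/- Let $m>0$ and let $A=(A_1,A_2,A_3)$ with $A_j\in L^3(\mathbb R^3)$ real-valued for $j=1,2,3$. Let $\sigma_1,\sigma_2,\sigma_3$ be the Pauli matrices, let $\alpha_j=\begin{pmatrix}0&\sigma_j\\ \sigma_j&0\end{pmatrix}$, $\beta=\begin{pmatrix}I_2&0\\0&-I_2\end{pmatrix}$ and $D=\frac1i\nabla$. In the Hilbert space $[L^2(\mathbb R^3)]^4$ let the magnetic Dirac operator $$H_A=\alpha\cdot(D-A(x))+m\beta$$ be the operator sum of the free Dirac operator $H_0=\alpha\cdot D+m\beta$ with domain $[H^1(\mathbb R^3)]^4$ and of the maximal operator of multiplication by the matrix-valued function $-\alpha\cdot A(x)$; its domain is the intersection of the two domains. Then $\operatorname{Dom}(H_A)=[H^1(\mathbb R^3)]^4$, $H_A$ is self-adjoint, and $$\sigma(H_A)=\sigma_{\rm ess}(H_A)=(-\infty,-m]\cup[m,\infty).$$ Here $\sigma(H_A)\subset\mathbb C$ is the spectrum, and $\sigma_{\rm ess}(H_A)$ is the set of those points of $\sigma(H_A)$ that are not isolated points of $\sigma(H_A)$ which are eigenvalues of finite multiplicity. -/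

import Mathlib

open MeasureTheory TemperedDistribution
open scoped LineDeriv SchwartzMap

/-! ### Spectral notions for unbounded operators on a complex normed space -/

section Spectrum

variable {V : Type*} [NormedAddCommGroup V] [NormedSpace ℂ V]

/-- The resolvent set of an unbounded operator `T`: the complex numbers `z` for which
`T - z : D(T) → V` is a bijection with bounded inverse `R` (defined on all of `V`). -/
def unboundedResolventSet (T : V →ₗ.[ℂ] V) : Set ℂ :=
  {z | ∃ R : V →L[ℂ] V,
    (∀ y : V, ∃ h : R y ∈ T.domain, T ⟨R y, h⟩ - z • R y = y) ∧
    (∀ x : T.domain, R (T x - z • (x : V)) = x)}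

/-- The spectrum of an unbounded operator. -/
def unboundedSpectrum (T : V →ₗ.[ℂ] V) : Set ℂ :=
  (unboundedResolventSet T)ᶜ

/-- The kernel of `T - z`, as a subspace of `V`: all `x ∈ D(T)` with `T x = z x`. -/
def unboundedEigenspace (T : V →ₗ.[ℂ] V) (z : ℂ) : Submodule ℂ V :=
  T.graph.comap (LinearMap.prod LinearMap.id (z • LinearMap.id))

/-- The discrete spectrum (of a self-adjoint operator): the isolated points of the spectrum that
are eigenvalues of finite multiplicity. -/
def discreteSpectrum (T : V →ₗ.[ℂ] V) : Set ℂ :=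
  {z | z ∈ unboundedSpectrum T ∧
    (∃ ε > 0, ∀ w ∈ unboundedSpectrum T, dist w z < ε → w = z) ∧
    unboundedEigenspace T z ≠ ⊥ ∧ FiniteDimensional ℂ (unboundedEigenspace T z)}

/-- The essential spectrum (of a self-adjoint operator): the complement of the discrete spectrum
in the spectrum. -/
def essentialSpectrum (T : V →ₗ.[ℂ] V) : Set ℂ :=
  unboundedSpectrum T \ discreteSpectrum T

end Spectrum

/-! ### The magnetic Dirac operator -/

noncomputable section Dirac

/-- The physical space `ℝ³`. -/
abbrev Space3 : Type := EuclideanSpace ℝ (Fin 3)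

/-- The spinor space `ℂ⁴ = ℂ² ⊕ ℂ²` (with its Hilbert space norm), coordinates being indexed by
the four-element type `Fin 2 ⊕ Fin 2` so that block matrices act on it. -/
abbrev Spinor : Type := EuclideanSpace ℂ (Fin 2 ⊕ Fin 2)

/-- The Hilbert space `[L²(ℝ³)]⁴`. -/
abbrev SpinorL2 : Type := Lp Spinor 2 (volume : Measure Space3)

/-- The Pauli matrices `σ₁, σ₂, σ₃`. -/
def pauliMatrix : Fin 3 → Matrix (Fin 2) (Fin 2) ℂ :=
  ![!![0, 1; 1, 0], !![0, -Complex.I; Complex.I, 0], !![1, 0; 0, -1]]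

/-- The Dirac matrices `αⱼ`, as linear maps of `ℂ⁴`. -/
def diracAlpha (j : Fin 3) : Spinor →L[ℂ] Spinor :=
  Matrix.toEuclideanCLM (𝕜 := ℂ) (Matrix.fromBlocks 0 (pauliMatrix j) (pauliMatrix j) 0)

/-- The Dirac matrix `β`, as a linear map of `ℂ⁴`. -/
def diracBeta : Spinor →L[ℂ] Spinor :=
  Matrix.toEuclideanCLM (𝕜 := ℂ) (Matrix.fromBlocks 1 0 0 (-1))

/-- The Sobolev space `[H¹(ℝ³)]⁴` as a subspace of `[L²(ℝ³)]⁴`. -/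
def sobolevH1 : Submodule ℂ SpinorL2 where
  carrier := {f | MemSobolev 1 2 (f : 𝓢'(Space3, Spinor))}
  zero_mem' := by
    have h := memSobolev_fun_zero Space3 Spinor 1 2
    rwa [← map_zero (Lp.toTemperedDistributionCLM Spinor (volume : Measure Space3) 2)] at h
  add_mem' {f g} hf hg := by
    have h := MemSobolev.add hf hg
    simp only [← Lp.toTemperedDistributionCLM_apply, ← map_add] at h
    exact h
  smul_mem' c f hf := by
    have h := MemSobolev.smul c hf
    simp only [← Lp.toTemperedDistributionCLM_apply, ← map_smul] at h
    exact h

theorem toTemperedDistribution_inj {f g : SpinorL2}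
    (h : (f : 𝓢'(Space3, Spinor)) = (g : 𝓢'(Space3, Spinor))) : f = g := by
  have hk := Lp.ker_toTemperedDistributionCLM_eq_bot (F := Spinor)
    (μ := (volume : Measure Space3)) (p := 2)
  exact LinearMap.ker_eq_bot.mp hk h

theorem exists_weakPartial (j : Fin 3) (f : sobolevH1) :
    ∃ g : SpinorL2, ∂_{EuclideanSpace.single j (1 : ℝ)} ((f : SpinorL2) : 𝓢'(Space3, Spinor)) =
      (g : 𝓢'(Space3, Spinor)) := by
  have h : MemSobolev 1 2 ((f : SpinorL2) : 𝓢'(Space3, Spinor)) := f.2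
  have h' := h.lineDerivOp (m := EuclideanSpace.single j (1 : ℝ))
  rw [sub_self] at h'
  exact memSobolev_zero_iff.mp h'

/-- The distributional partial derivative `∂ⱼ f ∈ [L²(ℝ³)]⁴` of `f ∈ [H¹(ℝ³)]⁴`. -/
def weakPartial (j : Fin 3) : sobolevH1 →ₗ[ℂ] SpinorL2 where
  toFun f := (exists_weakPartial j f).choose
  map_add' f g := by
    apply toTemperedDistribution_inj
    have hf := (exists_weakPartial j f).choose_spec
    have hg := (exists_weakPartial j g).choose_spec
    have hfg := (exists_weakPartial j (f + g)).choose_spec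
    rw [← hfg, ← Lp.toTemperedDistributionCLM_apply, ← Lp.toTemperedDistributionCLM_apply,
      Submodule.coe_add, map_add, map_add, Lp.toTemperedDistributionCLM_apply,
      Lp.toTemperedDistributionCLM_apply, Lp.toTemperedDistributionCLM_apply,
      Lp.toTemperedDistributionCLM_apply, ← hf, ← hg, LineDeriv.lineDerivOp_add]
  map_smul' c f := by
    apply toTemperedDistribution_inj
    have hf := (exists_weakPartial j f).choose_spec
    have hcf := (exists_weakPartial j (c • f)).choose_spec
    rw [← hcf, RingHom.id_apply, ← Lp.toTemperedDistributionCLM_apply,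
      ← Lp.toTemperedDistributionCLM_apply, Submodule.coe_smul, map_smul, map_smul,
      Lp.toTemperedDistributionCLM_apply, Lp.toTemperedDistributionCLM_apply, ← hf,
      LineDeriv.lineDerivOp_smul]

/-- The characterizing property of the weak partial derivative. -/
theorem weakPartial_spec (j : Fin 3) (f : sobolevH1) :
    ∂_{EuclideanSpace.single j (1 : ℝ)} ((f : SpinorL2) : 𝓢'(Space3, Spinor)) =
      (weakPartial j f : 𝓢'(Space3, Spinor)) :=
  (exists_weakPartial j f).choose_spec

/-- The free Dirac operator `H₀ = α · D + m β`, `D = -i ∇`, with domain `[H¹(ℝ³)]⁴`. A matrix acts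
on a spinor field pointwise. -/
def freeDirac (m : ℝ) : SpinorL2 →ₗ.[ℂ] SpinorL2 where
  domain := sobolevH1
  toFun :=
    (∑ j : Fin 3, (-Complex.I) •
      ((diracAlpha j).compLpL 2 (volume : Measure Space3)).toLinearMap ∘ₗ weakPartial j) +
    (m : ℂ) • (diracBeta.compLpL 2 (volume : Measure Space3)).toLinearMap ∘ₗ sobolevH1.subtype

/-- The pointwise product `(α · A(x)) f(x) = ∑ⱼ Aⱼ(x) αⱼ f(x)`. -/
def alphaDotMul (A : Fin 3 → Space3 → ℝ) (f : Space3 → Spinor) (x : Space3) : Spinor :=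
  ∑ j : Fin 3, (A j x : ℂ) • diracAlpha j (f x)

theorem alphaDotMul_add_ae (A : Fin 3 → Space3 → ℝ) (f g : SpinorL2) :
    alphaDotMul A (f + g : SpinorL2) =ᵐ[volume] alphaDotMul A f + alphaDotMul A g := by
  filter_upwards [Lp.coeFn_add f g] with x hx
  simp only [alphaDotMul, hx, Pi.add_apply, map_add, smul_add, Finset.sum_add_distrib]

theorem alphaDotMul_smul_ae (A : Fin 3 → Space3 → ℝ) (c : ℂ) (f : SpinorL2) :
    alphaDotMul A (c • f : SpinorL2) =ᵐ[volume] c • alphaDotMul A f := by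
  filter_upwards [Lp.coeFn_smul c f] with x hx
  simp only [alphaDotMul, hx, Pi.smul_apply, map_smul, Finset.smul_sum]
  exact Finset.sum_congr rfl fun j _ => smul_comm _ _ _

theorem alphaDotMul_zero_ae (A : Fin 3 → Space3 → ℝ) :
    alphaDotMul A (0 : SpinorL2) =ᵐ[volume] 0 := by
  filter_upwards [Lp.coeFn_zero Spinor 2 (volume : Measure Space3)] with x hx
  simp only [alphaDotMul, hx, Pi.zero_apply, map_zero, smul_zero, Finset.sum_const_zero]

/-- The (maximal) operator of multiplication by the matrix-valued function `α · A(x)`, with domain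
all `f ∈ [L²(ℝ³)]⁴` such that `(α · A) f ∈ [L²(ℝ³)]⁴`. -/
def magneticPotential (A : Fin 3 → Space3 → ℝ) : SpinorL2 →ₗ.[ℂ] SpinorL2 where
  domain :=
    { carrier := {f | MemLp (alphaDotMul A f) 2 (volume : Measure Space3)}
      zero_mem' := (memLp_congr_ae (alphaDotMul_zero_ae A)).mpr MemLp.zero
      add_mem' := fun {f g} hf hg =>
        (memLp_congr_ae (alphaDotMul_add_ae A f g)).mpr (MemLp.add hf hg)
      smul_mem' := fun c f hf =>
        (memLp_congr_ae (alphaDotMul_smul_ae A c f)).mpr (MemLp.const_smul hf c) }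
  toFun :=
    { toFun := fun f => MemLp.toLp (alphaDotMul A (f : SpinorL2)) f.2
      map_add' := fun f g => by
        rw [← MemLp.toLp_add]
        exact MemLp.toLp_congr _ _ (alphaDotMul_add_ae A f g)
      map_smul' := fun c f => by
        rw [RingHom.id_apply, ← MemLp.toLp_const_smul]
        exact MemLp.toLp_congr _ _ (alphaDotMul_smul_ae A c f) }

/-- The magnetic Dirac operator `H_A = α · (D - A) + m β`, as the operator sum of `H₀` and `-α · A`;
its domain is the intersection of the domains of the two operators. -/
def magneticDirac (m : ℝ) (A : Fin 3 → Space3 → ℝ) : SpinorL2 →ₗ.[ℂ] SpinorL2 :=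
  freeDirac m - magneticPotential A

end Dirac

/-! Domain and self-adjointness come from a relative bound on the potential. Since $H^1(\mathbb
R^3)\subset L^6$ and $1/3+1/6=1/2$, Hölder's inequality makes $(\alpha\cdot A)f$ square integrable
for every $f\in H^1$ (`sobolevH1_le_magneticPotential_domain`). Splitting each $A_j$ into a bounded
part and a part small in $L^3$ gives $\|(\alpha\cdot
A)f\|\le\varepsilon\sum_j\|\partial_jf\|+K\|f\|$ with $\varepsilon$ arbitrary. On the Fourier side
$\|(H_0-i\mu)f\|$ dominates each $\|\partial_jf\|$ and also $|\mu|\,\|f\|$, so for large $|\mu|$ the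
potential is at most half of $H_0-i\mu$ (`exists_norm_potentialOnH1_le_half_mul_norm`). A Neumann
series makes $H_A\mp i\mu$ onto, and a symmetric operator with this property is self-adjoint.

The gap $(-m,m)$ comes from supersymmetry. Put $Q=\alpha\cdot(D-A)$. Since $\beta$ anticommutes with
$Q$, the cross term in $\|Qf+m\beta f\|^2$ vanishes and $\|H_Af\|^2=\|Qf\|^2+m^2\|f\|^2$
(`mul_norm_le_norm_freeDirac_sub_potentialOnH1`).

For $|t|\ge m$ there are a momentum $p$ and a spinor $u\ne0$ with $(\alpha\cdot p+m\beta)u=tu$. On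
trial functions $e^{ip\cdot x}\rho(x)u$ the operator $H_0-t$ only sees the gradient of the envelope
$\rho u$. So does the potential: its norm is blind to the phase and, by the scale invariance of
$L^3(\mathbb R^3)$, bounded by the gradient alone. If $t$ were in the resolvent set, $\|\rho\|\le
C\|\nabla\rho\|$ would hold for all test functions
(`exists_norm_le_sum_fderiv_of_mem_resolventSet`), which fails under dilation.

Hence the spectrum is $(-\infty,-m]\cup[m,\infty)$. It has no isolated points, so the discrete
spectrum is empty. -/

/-! ### Symmetric and self-adjoint operators: criteria for self-adjointness and for the resolvent
set. -/

section AbstractOperators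

open LinearPMap
open scoped InnerProductSpace

variable {H : Type*} [NormedAddCommGroup H] [InnerProductSpace ℂ H]

theorem im_inner_eq_zero_of_isFormalAdjoint {T : H →ₗ.[ℂ] H} (hT : T.IsFormalAdjoint T)
    (x : T.domain) : (⟪(x : H), T x⟫_ℂ).im = 0 := by
  have h := hT x x
  rw [← inner_conj_symm] at h
  exact Complex.conj_eq_iff_im.mp h

/-- A symmetric operator `T` satisfies `|Im z| ‖x‖ ≤ ‖(T - z) x‖`. -/
theorem abs_im_mul_norm_le_of_isFormalAdjoint {T : H →ₗ.[ℂ] H} (hT : T.IsFormalAdjoint T)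
    (z : ℂ) (x : T.domain) : |z.im| * ‖(x : H)‖ ≤ ‖T x - z • (x : H)‖ := by
  rcases eq_or_ne (x : H) 0 with hx | hx
  · simp [hx]
  have h1 : |(⟪(x : H), T x - z • (x : H)⟫_ℂ).im| = |z.im| * ‖(x : H)‖ * ‖(x : H)‖ := by
    rw [inner_sub_right, inner_smul_right, inner_self_eq_norm_sq_to_K, Complex.sub_im,
      im_inner_eq_zero_of_isFormalAdjoint hT x]
    have : (z * ((‖(x : H)‖ : ℂ)) ^ 2).im = z.im * (‖(x : H)‖ * ‖(x : H)‖) := by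
      rw [← Complex.ofReal_pow, Complex.im_mul_ofReal, sq]
    simp only [Complex.coe_algebraMap, this, zero_sub, abs_neg, abs_mul, abs_norm]
    ring
  have h2 : |(⟪(x : H), T x - z • (x : H)⟫_ℂ).im| ≤ ‖T x - z • (x : H)‖ * ‖(x : H)‖ :=
    (Complex.abs_im_le_norm _).trans ((norm_inner_le_norm _ _).trans_eq (mul_comm _ _))
  rw [h1] at h2
  exact le_of_mul_le_mul_right h2 (norm_pos_iff.mpr hx)

/-- A symmetric operator `T` for which `T - iμ` and `T + iμ` are onto is self-adjoint. -/
theorem isSelfAdjoint_of_isFormalAdjoint_of_surjective [CompleteSpace H] {T : H →ₗ.[ℂ] H}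
    (hT : T.IsFormalAdjoint T) {μ : ℝ} (hμ : μ ≠ 0)
    (h₁ : ∀ y, ∃ x : T.domain, T x - (μ * Complex.I) • (x : H) = y)
    (h₂ : ∀ y, ∃ x : T.domain, T x - (-(μ * Complex.I)) • (x : H) = y) :
    IsSelfAdjoint T := by
  have him : (μ * Complex.I).im = μ := by simp
  -- If $y=(T-i\mu)x$ is orthogonal to the domain, then $\langle x,(T-i\mu)x\rangle=0$. Its
  -- imaginary part is $-\mu\|x\|^2$, so $x=0$.
  have hdense : Dense (T.domain : Set H) := by
    rw [Submodule.dense_iff_topologicalClosure_eq_top,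
      Submodule.topologicalClosure_eq_top_iff, Submodule.eq_bot_iff]
    intro y hy
    obtain ⟨x, rfl⟩ := h₁ y
    have h := (Submodule.mem_orthogonal _ _).mp hy x x.2
    have h3 : (⟪(x : H), T x - (μ * Complex.I) • (x : H)⟫_ℂ).im = 0 := by rw [h]; rfl
    rw [inner_sub_right, inner_smul_right, inner_self_eq_norm_sq_to_K, Complex.sub_im,
      im_inner_eq_zero_of_isFormalAdjoint hT x] at h3
    have : (μ * Complex.I * ((‖(x : H)‖ : ℂ)) ^ 2).im = μ * ‖(x : H)‖ ^ 2 := by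
      rw [← Complex.ofReal_pow, Complex.im_mul_ofReal, him]
    simp only [Complex.coe_algebraMap, this, zero_sub, neg_eq_zero, mul_eq_zero, hμ, false_or,
      pow_eq_zero_iff two_ne_zero, norm_eq_zero] at h3
    have hx : x = 0 := Subtype.ext h3
    simp [hx]
  have hle : T ≤ T† := IsFormalAdjoint.le_adjoint hdense hT
  refine LinearPMap.isSelfAdjoint_def.mpr (le_antisymm ?_ hle)
  -- Given $y\in D(T^\dagger)$, choose $x\in D(T)$ with $(T-i\mu)x=(T^\dagger-i\mu)y$. Then
  -- $y-x\in\ker(T^\dagger-i\mu)$, which is orthogonal to the range of $T+i\mu$, that is, to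
  -- everything.
  have hdom : T†.domain ≤ T.domain := by
    intro y hy
    obtain ⟨x, hx⟩ := h₁ (T† ⟨y, hy⟩ - (μ * Complex.I) • y)
    have hxd : (x : H) ∈ T†.domain := hle.1 x.2
    have hTx : T† ⟨x, hxd⟩ = T x := (hle.2 rfl).symm
    have hz : y - x = 0 := by
      obtain ⟨w, hw⟩ := h₂ (y - x)
      have e1 : T† (⟨y, hy⟩ - ⟨x, hxd⟩) = (μ * Complex.I) • (y - x) := by
        rw [LinearPMap.map_sub, hTx, smul_sub, sub_eq_sub_iff_sub_eq_sub, ← hx]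
      have e2 := adjoint_isFormalAdjoint hdense (⟨y, hy⟩ - ⟨x, hxd⟩) w
      rw [e1, inner_smul_left] at e2
      have e3 : ⟪y - x, T w - (-(μ * Complex.I)) • (w : H)⟫_ℂ = 0 := by
        rw [inner_sub_right, inner_smul_right]
        change _ = ⟪y - x, T w⟫_ℂ at e2
        rw [← e2]
        simp
      rw [hw] at e3
      exact inner_self_eq_zero.mp e3
    rw [sub_eq_zero.mp hz]
    exact x.2
  exact ⟨hdom, fun {x y} hxy => (hle.2 hxy.symm).symm⟩

/-- If `z` is in the resolvent set of `T` then `T - z` is bounded below. -/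
theorem exists_pos_mul_norm_le_of_mem_unboundedResolventSet {T : H →ₗ.[ℂ] H} {z : ℂ}
    (hz : z ∈ unboundedResolventSet T) :
    ∃ C : ℝ, ∀ x : T.domain, ‖(x : H)‖ ≤ C * ‖T x - z • (x : H)‖ := by
  obtain ⟨R, -, hR⟩ := hz
  refine ⟨‖R‖, fun x => ?_⟩
  conv_lhs => rw [← hR x]
  exact R.le_opNorm _

/-- If `T` is self-adjoint, and `T - z` and `T - conj z` are bounded below, then `z` is in the
resolvent set. -/
theorem mem_unboundedResolventSet_of_isSelfAdjoint [CompleteSpace H] {T : H →ₗ.[ℂ] H}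
    (hT : IsSelfAdjoint T) {z : ℂ} {c : ℝ} (hc : 0 < c)
    (h₁ : ∀ x : T.domain, c * ‖(x : H)‖ ≤ ‖T x - z • (x : H)‖)
    (h₂ : ∀ x : T.domain, c * ‖(x : H)‖ ≤ ‖T x - (starRingEnd ℂ z) • (x : H)‖) :
    z ∈ unboundedResolventSet T := by
  have hdense := hT.dense_domain
  have hadj : T† = T := hT
  let L : T.domain →ₗ[ℂ] H := T.toFun - z • T.domain.subtype
  have hL : ∀ x, L x = T x - z • (x : H) := fun _ => rfl
  -- The orthogonal complement of the range of $T-z$ is $\ker(T^\dagger-\bar z)=\ker(T-\bar z)$,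
  -- trivial by `h₂`.
  have hbot : (LinearMap.range L)ᗮ = ⊥ := by
    rw [Submodule.eq_bot_iff]
    intro y hy
    have hy' : ∀ x : T.domain, ⟪(starRingEnd ℂ z) • y, x⟫_ℂ = ⟪y, T x⟫_ℂ := by
      intro x
      have h := (Submodule.mem_orthogonal' _ _).mp hy (L x) ⟨x, rfl⟩
      rw [hL, inner_sub_right, inner_smul_right, sub_eq_zero] at h
      rw [inner_smul_left, h, Complex.conj_conj]
    have hyd : y ∈ T†.domain := mem_adjoint_domain_of_exists y ⟨_, hy'⟩
    have hTy := adjoint_apply_eq hdense ⟨y, hyd⟩ hy'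
    have hle : T† ≤ T := hadj.le
    have h := h₂ ⟨y, hle.1 hyd⟩
    rw [← hle.2 (x := ⟨y, hyd⟩) rfl, hTy, sub_self, norm_zero] at h
    exact norm_eq_zero.mp (le_antisymm (nonpos_of_mul_nonpos_right h hc) (norm_nonneg _))
  -- The lower bound makes preimages of a Cauchy sequence Cauchy, and the graph of a self-adjoint
  -- operator is closed.
  have hclosed : IsClosed (LinearMap.range L : Set H) := by
    rw [← isSeqClosed_iff_isClosed]
    intro y y₀ hy hy₀
    choose x hx using hy
    have hcau : CauchySeq (fun n => ((x n : T.domain) : H)) := by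
      have hyc := hy₀.cauchySeq
      rw [Metric.cauchySeq_iff'] at hyc ⊢
      intro ε hε
      obtain ⟨N, hN⟩ := hyc (c * ε) (by positivity)
      refine ⟨N, fun n hn => ?_⟩
      have h := hN n hn
      have h' := h₁ (x n - x N)
      rw [← hL, _root_.map_sub, hx, hx, ← dist_eq_norm, AddSubgroupClass.coe_sub, ← dist_eq_norm] at h'
      exact lt_of_mul_lt_mul_left (h'.trans_lt h) hc.le
    obtain ⟨x₀, hx₀⟩ := cauchySeq_tendsto_of_complete hcau
    have hTx : Filter.Tendsto (fun n => T (x n)) Filter.atTop (nhds (y₀ + z • x₀)) := by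
      have : (fun n => T (x n)) = fun n => y n + z • (x n : H) := by
        funext n; rw [← hx, hL]; abel
      rw [this]
      exact hy₀.add (hx₀.const_smul z)
    have hg : (x₀, y₀ + z • x₀) ∈ T.graph :=
      hT.isClosed.mem_of_tendsto (hx₀.prodMk_nhds hTx)
        (Filter.Eventually.of_forall fun n => T.mem_graph (x n))
    obtain ⟨w, hw1, hw2⟩ := (LinearPMap.mem_graph_iff T).mp hg
    refine ⟨w, ?_⟩
    rw [hL, hw2]
    simp only at hw1
    rw [hw1]; simp
  have hsurj : LinearMap.range L = ⊤ := by
    have := Submodule.topologicalClosure_eq_top_iff.mpr hbot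
    rwa [hclosed.submodule_topologicalClosure_eq] at this
  have hinj : Function.Injective L := by
    rw [← LinearMap.ker_eq_bot, LinearMap.ker_eq_bot']
    intro x hx
    have h := h₁ x
    rw [← hL, hx, norm_zero] at h
    exact Subtype.ext
      (norm_eq_zero.mp (le_antisymm (nonpos_of_mul_nonpos_right h hc) (norm_nonneg _)))
  let e := LinearEquiv.ofBijective L ⟨hinj, LinearMap.range_eq_top.mp hsurj⟩
  have he : ∀ x, e x = L x := fun _ => rfl
  refine ⟨(T.domain.subtype ∘ₗ e.symm.toLinearMap).mkContinuous c⁻¹ fun y => ?_,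
    fun y => ⟨(e.symm y).2, ?_⟩, fun x => ?_⟩
  · have h := h₁ (e.symm y)
    rw [← hL, ← he, e.apply_symm_apply] at h
    rw [inv_mul_eq_div, le_div_iff₀' hc]
    exact h
  · exact e.apply_symm_apply y
  · change ((e.symm (L x) : T.domain) : H) = x
    rw [← he, e.symm_apply_apply]

/-- A perturbation of a bijective operator `L` by an operator `V` with `‖V x‖ ≤ c ‖L x‖`, `c < 1`,
is onto. -/
theorem exists_sub_eq_of_norm_le_mul_norm [CompleteSpace H] {D : Submodule ℂ H}
    {L V : D →ₗ[ℂ] H} (hL : Function.Bijective L) {c : ℝ} (hc : c < 1)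
    (h : ∀ x, ‖V x‖ ≤ c * ‖L x‖) (y : H) : ∃ x, L x - V x = y := by
  let e := LinearEquiv.ofBijective L hL
  have he : ∀ x, e x = L x := fun _ => rfl
  -- $B=VL^{-1}$ has norm less than one and $L-V=(1-B)L$, so the preimage of $y$ is
  -- $L^{-1}(1-B)^{-1}y$.
  let B : H →L[ℂ] H := (V ∘ₗ e.symm.toLinearMap).mkContinuous c fun y => by
    have := h (e.symm y)
    rw [← he, e.apply_symm_apply] at this
    exact this
  have hB : ‖B‖ < 1 := by
    refine (LinearMap.mkContinuous_norm_le' _ _).trans_lt (max_lt hc one_pos)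
  obtain ⟨u, hu⟩ := isUnit_one_sub_of_norm_lt_one hB
  have hy : (1 - B) ((↑u⁻¹ : H →L[ℂ] H) y) = y := by
    rw [← hu, ← mul_apply_eq_comp, Units.mul_inv]; rfl
  refine ⟨e.symm ((↑u⁻¹ : H →L[ℂ] H) y), ?_⟩
  rw [← he, e.apply_symm_apply]
  exact hy

end AbstractOperators

/-! ### Fourier description of derivatives and of $H^1$; density of Schwartz functions. -/

section FourierMultipliers

open FourierTransform Filter Topology
open scoped ENNReal ContDiff

variable {E F : Type*} [NormedAddCommGroup E] [InnerProductSpace ℝ E] [FiniteDimensional ℝ E]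
  [MeasurableSpace E] [BorelSpace E] [NormedAddCommGroup F]

/-- If `h f = g` as tempered distributions, where `f, g` are `L²` functions, then `g = h f` almost
everywhere. -/
theorem ae_eq_smul_of_smulLeftCLM_eq [NormedSpace ℂ F] [CompleteSpace F]
    {h : E → ℂ} (hh : h.HasTemperateGrowth)
    {f g : Lp F 2 (volume : Measure E)} (hfg : smulLeftCLM F h (f : 𝓢'(E, F)) = (g : 𝓢'(E, F))) :
    g =ᵐ[volume] fun x => h x • f x := by
  refine ae_eq_of_integral_contDiff_smul_eq ((Lp.memLp g).locallyIntegrable one_le_two) ?_ ?_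
  · have := ((Lp.memLp f).locallyIntegrable one_le_two).locallyIntegrableOn Set.univ
    exact locallyIntegrableOn_univ.mp
      (this.continuousOn_smul isOpen_univ.isLocallyClosed hh.1.continuous.continuousOn)
  · intro u hu hu'
    have hg₁ : HasCompactSupport (Complex.ofRealCLM ∘ u) := hu'.comp_left rfl
    have hg₂ : ContDiff ℝ ∞ (Complex.ofRealCLM ∘ u) := by fun_prop
    have := DFunLike.congr_fun hfg (hg₁.toSchwartzMap hg₂)
    simp only [smulLeftCLM_apply_apply, Lp.toTemperedDistribution_apply,
      SchwartzMap.smulLeftCLM_apply_apply hh] at this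
    have h1 : ∀ x, (hg₁.toSchwartzMap hg₂) x = (u x : ℂ) := fun x => rfl
    simp only [h1] at this
    refine Eq.trans ?_ (this.symm.trans ?_)
    · simp only [Complex.coe_smul]
    · refine integral_congr_ae (Eventually.of_forall fun x => ?_)
      simp only [smul_eq_mul, mul_comm (h x), mul_smul, Complex.coe_smul]

/-- If `g = h f` almost everywhere for `L²` functions `f, g`, then `h f = g` as tempered
distributions. -/
theorem smulLeftCLM_eq_of_ae_eq_smul [NormedSpace ℂ F] [CompleteSpace F]
    {h : E → ℂ} (hh : h.HasTemperateGrowth)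
    {f g : Lp F 2 (volume : Measure E)} (hfg : g =ᵐ[volume] fun x => h x • f x) :
    smulLeftCLM F h (f : 𝓢'(E, F)) = (g : 𝓢'(E, F)) := by
  ext u
  simp only [Lp.toTemperedDistribution_apply, smulLeftCLM_apply_apply]
  apply integral_congr_ae
  filter_upwards [hfg] with x hx
  simp [hx, hh, smul_smul, mul_comm]

/-- The Fourier transform of a distributional derivative. -/
theorem fourier_ae_eq_of_lineDerivOp_eq [InnerProductSpace ℂ F] [CompleteSpace F]
    {f g : Lp F 2 (volume : Measure E)} {v : E}
    (hfg : ∂_{v} (f : 𝓢'(E, F)) = (g : 𝓢'(E, F))) :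
    (𝓕 g : Lp F 2 (volume : Measure E)) =ᵐ[volume] fun ξ =>
      (2 * Real.pi * Complex.I * (inner ℝ ξ v : ℝ) : ℂ) • (𝓕 f : Lp F 2 (volume : Measure E)) ξ := by
  have h1 := congrArg 𝓕 hfg
  have ht : (fun ξ : E => ((inner ℝ ξ v : ℝ) : ℂ)).HasTemperateGrowth := by fun_prop
  rw [fourier_lineDerivOp_eq, Lp.fourier_toTemperedDistribution_eq,
    Lp.fourier_toTemperedDistribution_eq, ← smul_apply,
    ← smulLeftCLM_smul ht] at h1
  filter_upwards [ae_eq_smul_of_smulLeftCLM_eq (by fun_prop) h1] with ξ hξ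
  rw [hξ]; rfl

/-- Applying a fixed bounded operator pointwise commutes with the embedding into distributions. -/
theorem toTemperedDistribution_compLpL_apply [NormedSpace ℂ F] [CompleteSpace F]
    (L : F →L[ℂ] F) (f : Lp F 2 (volume : Measure E)) (u : 𝓢(E, ℂ)) :
    (L.compLpL 2 volume f : 𝓢'(E, F)) u = L ((f : 𝓢'(E, F)) u) := by
  have hint : Integrable (fun x => u x • f x) :=
    memLp_one_iff_integrable.mp ((Lp.memLp f).smul (r := 1) (u.memLp 2 volume))
  rw [Lp.toTemperedDistribution_apply, Lp.toTemperedDistribution_apply,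
    ← L.integral_comp_comm hint]
  apply integral_congr_ae
  filter_upwards [L.coeFn_compLpL f] with x hx
  rw [hx, map_smul]

/-- Applying a fixed bounded operator pointwise commutes with the Fourier transform. -/
theorem fourier_compLpL [InnerProductSpace ℂ F] [CompleteSpace F]
    (L : F →L[ℂ] F) (f : Lp F 2 (volume : Measure E)) :
    𝓕 (L.compLpL 2 volume f) = L.compLpL 2 volume (𝓕 f) := by
  refine LinearMap.ker_eq_bot.mp (Lp.ker_toTemperedDistributionCLM_eq_bot (F := F)
    (μ := (volume : Measure E)) (p := 2)) ?_
  ext u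
  simp only [ContinuousLinearMap.coe_coe, Lp.toTemperedDistributionCLM_apply]
  rw [toTemperedDistribution_compLpL_apply, ← Lp.fourier_toTemperedDistribution_eq,
    ← Lp.fourier_toTemperedDistribution_eq, TemperedDistribution.fourier_apply, TemperedDistribution.fourier_apply,
    toTemperedDistribution_compLpL_apply]

/-- An `L²` function is in the Sobolev space of order one if and only if `(1 + |ξ|²)^{1/2}` times
its Fourier transform is in `L²`. -/
theorem memSobolev_one_iff_exists_ae_eq [InnerProductSpace ℂ F] [CompleteSpace F]
    (f : Lp F 2 (volume : Measure E)) :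
    MemSobolev 1 2 (f : 𝓢'(E, F)) ↔ ∃ w : Lp F 2 (volume : Measure E),
      w =ᵐ[volume] fun ξ => (((1 + ‖ξ‖ ^ 2) ^ ((1 : ℝ) / 2) : ℝ) : ℂ) •
        (𝓕 f : Lp F 2 (volume : Measure E)) ξ := by
  have hh : (fun ξ : E => (((1 + ‖ξ‖ ^ 2) ^ ((1 : ℝ) / 2) : ℝ) : ℂ)).HasTemperateGrowth := by
    fun_prop
  rw [memSobolev_iff_exists_smulLeftCLM_fourier, Lp.fourier_toTemperedDistribution_eq]
  exact exists_congr fun w =>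
    ⟨ae_eq_smul_of_smulLeftCLM_eq hh, smulLeftCLM_eq_of_ae_eq_smul hh⟩

/-- A function in the Sobolev space of order one is the limit of a sequence of Schwartz functions,
whose partial derivatives converge as well. -/
theorem exists_schwartz_tendsto_of_memSobolev_one [InnerProductSpace ℂ F] [CompleteSpace F]
    {f : Lp F 2 (volume : Measure E)} (hf : MemSobolev 1 2 (f : 𝓢'(E, F))) :
    ∃ φ : ℕ → 𝓢(E, F), Tendsto (fun n => (φ n).toLp 2) atTop (𝓝 f) ∧
      ∀ (v : E) (g : Lp F 2 (volume : Measure E)), ∂_{v} (f : 𝓢'(E, F)) = (g : 𝓢'(E, F)) →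
        Tendsto (fun n => (∂_{v} (φ n) : 𝓢(E, F)).toLp 2) atTop (𝓝 g) := by
  obtain ⟨w, hw⟩ := (memSobolev_one_iff_exists_ae_eq f).mp hf
  have hd := SchwartzMap.denseRange_toLpCLM (E := E) (F := F) (p := 2)
    (μ := (volume : Measure E)) ENNReal.ofNat_ne_top
  obtain ⟨h, hh, hhw⟩ := mem_closure_iff_seq_limit.mp (hd w)
  choose ψ hψ using hh
  have hψw : Tendsto (fun n => ‖(ψ n).toLp 2 volume - w‖) atTop (𝓝 0) := by
    rw [← tendsto_iff_norm_sub_tendsto_zero]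
    convert hhw using 2 with n
    exact hψ n
  -- With $w=(1+|\xi|^2)^{1/2}\hat f$ and Schwartz $\psi_n\to w$ in $L^2$, the approximants are
  -- $\varphi_n=\mathcal F^{-1}(J\psi_n)$. The bounds $J\le1$ and $|\xi|J\le1$ give convergence of
  -- the functions and of their derivatives.
  set J : E → ℂ := fun ξ => (((1 + ‖ξ‖ ^ 2) ^ (-(1 : ℝ) / 2) : ℝ) : ℂ) with hJ
  have hJt : J.HasTemperateGrowth := by fun_prop
  let φ : ℕ → 𝓢(E, F) := fun n => 𝓕⁻ (SchwartzMap.smulLeftCLM F J (ψ n))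
  have hJnorm : ∀ ξ, ‖J ξ‖ ^ 2 * (1 + ‖ξ‖ ^ 2) = 1 := by
    intro ξ
    have h0 : 0 < 1 + ‖ξ‖ ^ 2 := by positivity
    rw [hJ, Complex.norm_real, Real.norm_of_nonneg (by positivity), ← Real.rpow_natCast,
      ← Real.rpow_mul h0.le]
    norm_num
    rw [Real.rpow_neg_one, inv_mul_cancel₀ h0.ne']
  have hJw : (𝓕 f : Lp F 2 (volume : Measure E)) =ᵐ[volume] fun ξ => J ξ • w ξ := by
    filter_upwards [hw] with ξ hξ
    have h0 : 0 < 1 + ‖ξ‖ ^ 2 := by positivity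
    rw [hξ, smul_smul, hJ, ← Complex.ofReal_mul, ← Real.rpow_add h0]
    norm_num
  have hφ : ∀ n, (𝓕 ((φ n).toLp 2 volume) : Lp F 2 (volume : Measure E)) =ᵐ[volume]
      fun ξ => J ξ • (ψ n).toLp 2 volume ξ := by
    intro n
    rw [SchwartzMap.toLp_fourier_eq, FourierTransform.fourier_fourierInv_eq]
    filter_upwards [SchwartzMap.coeFn_toLp (SchwartzMap.smulLeftCLM F J (ψ n)) 2 volume,
      SchwartzMap.coeFn_toLp (ψ n) 2 volume] with ξ h1 h2
    rw [h1, h2, SchwartzMap.smulLeftCLM_apply_apply hJt]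
  have hdiff : ∀ (n : ℕ), (𝓕 ((φ n).toLp 2 volume - f) : Lp F 2 (volume : Measure E)) =ᵐ[volume]
      fun ξ => J ξ • ((ψ n).toLp 2 volume - w : Lp F 2 (volume : Measure E)) ξ := by
    intro n
    have hsub : (𝓕 ((φ n).toLp 2 volume - f) : Lp F 2 (volume : Measure E)) =
        𝓕 ((φ n).toLp 2 volume) - 𝓕 f := _root_.map_sub (Lp.fourierTransformₗᵢ E F) _ _
    rw [hsub]
    filter_upwards [hφ n, hJw, Lp.coeFn_sub (𝓕 ((φ n).toLp 2 volume)) (𝓕 f),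
      Lp.coeFn_sub ((ψ n).toLp 2 volume) w] with ξ h1 h2 h3 h4
    rw [h3, h4, Pi.sub_apply, Pi.sub_apply, h1, h2, smul_sub]
  refine ⟨φ, ?_, fun v g hg => ?_⟩
  · rw [tendsto_iff_norm_sub_tendsto_zero]
    refine squeeze_zero (fun _ => norm_nonneg _) (fun n => ?_) hψw
    rw [← Lp.norm_fourier_eq]
    refine Lp.norm_le_norm_of_ae_le ?_
    filter_upwards [hdiff n] with ξ hξ
    rw [hξ, norm_smul]
    refine mul_le_of_le_one_left (norm_nonneg _) ?_
    nlinarith [hJnorm ξ, norm_nonneg (J ξ), sq_nonneg (‖J ξ‖ * ‖ξ‖)]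
  · rw [tendsto_iff_norm_sub_tendsto_zero]
    refine squeeze_zero (fun _ => norm_nonneg _) (fun n => ?_)
      (by simpa using hψw.const_mul (2 * Real.pi * ‖v‖))
    have hder : ∂_{v} (((φ n).toLp 2 volume - f : Lp F 2 (volume : Measure E)) : 𝓢'(E, F)) =
        (((∂_{v} (φ n) : 𝓢(E, F)).toLp 2 volume - g : Lp F 2 (volume : Measure E)) : 𝓢'(E, F)) := by
      have hsub : ∀ a b : 𝓢'(E, F), ∂_{v} (a - b) = ∂_{v} a - ∂_{v} b :=
        _root_.map_sub (LineDeriv.lineDerivOpCLM ℂ 𝓢'(E, F) v)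
      simp only [← Lp.toTemperedDistributionCLM_apply, _root_.map_sub, hsub]
      simp only [Lp.toTemperedDistributionCLM_apply, hg, Lp.toTemperedDistribution_toLp_eq,
        TemperedDistribution.lineDerivOp_toTemperedDistributionCLM_eq]
    rw [← Lp.norm_fourier_eq]
    refine Lp.norm_le_mul_norm_of_ae_le_mul ?_
    filter_upwards [hdiff n, fourier_ae_eq_of_lineDerivOp_eq hder] with ξ h1 h2
    rw [h2, h1, smul_smul, norm_smul, norm_mul, norm_mul, norm_mul, norm_mul, Complex.norm_I,
      Complex.norm_real, Complex.norm_real, Complex.norm_ofNat, mul_one, Real.norm_of_nonneg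
      Real.pi_pos.le, mul_assoc (2 * Real.pi)]
    gcongr
    have h3 : ‖ξ‖ * ‖J ξ‖ ≤ 1 := by
      nlinarith [hJnorm ξ, norm_nonneg (J ξ), norm_nonneg ξ, sq_nonneg (‖J ξ‖),
        mul_nonneg (norm_nonneg ξ) (norm_nonneg (J ξ))]
    calc ‖(inner ℝ ξ v : ℝ)‖ * ‖J ξ‖ ≤ ‖ξ‖ * ‖v‖ * ‖J ξ‖ := by
          gcongr; exact norm_inner_le_norm ξ v
      _ = ‖v‖ * (‖ξ‖ * ‖J ξ‖) := by ring
      _ ≤ ‖v‖ := mul_le_of_le_one_right (norm_nonneg _) h3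

end FourierMultipliers

/-! ### The Sobolev inequality $H^1(\mathbb R^3)\subset L^6$. -/

section SobolevInequality

open Filter Topology
open scoped ENNReal NNReal ContDiff

/-- The Gagliardo-Nirenberg-Sobolev inequality for Schwartz functions in dimension three. -/
theorem eLpNorm_six_le_eLpNorm_fderiv {E F : Type*} [NormedAddCommGroup E] [InnerProductSpace ℝ E]
    [FiniteDimensional ℝ E] [MeasurableSpace E] [BorelSpace E] [NormedAddCommGroup F]
    [NormedSpace ℝ F] [FiniteDimensional ℝ F] (hE : Module.finrank ℝ E = 3) (u : 𝓢(E, F)) :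
    eLpNorm u 6 volume ≤
      SNormLESNormFDerivOfEqConst F (volume : Measure E) 2 * eLpNorm (fderiv ℝ u) 2 volume := by
  set C : ℝ≥0 := SNormLESNormFDerivOfEqConst F (volume : Measure E) 2
  let χ : ContDiffBump (0 : E) := ⟨1, 2, one_pos, one_lt_two⟩
  obtain ⟨K, hK⟩ : ∃ K : ℝ, ∀ x, ‖fderiv ℝ χ x‖ ≤ K :=
    (χ.hasCompactSupport.fderiv ℝ).exists_bound_of_continuous
      ((χ.contDiff (n := 1)).continuous_fderiv one_ne_zero)
  have hK0 : 0 ≤ K := (norm_nonneg _).trans (hK 0)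
  let c : ℕ → ℝ := fun n => 1 / ((n : ℝ) + 1)
  have hc : ∀ n, 0 < c n := fun n => by positivity
  have hc0 : Tendsto c atTop (𝓝 0) := tendsto_one_div_add_atTop_nhds_zero_nat
  -- The inequality is applied to the cutoffs $\chi(c_nx)u$ with $c_n=1/(n+1)$. The gradient of the
  -- cutoff costs at most $c_nK|u|$, which tends to zero in $L^2$; Fatou's lemma then recovers $u$.
  let v : ℕ → E → F := fun n x => χ (c n • x) • u x
  have hv : ∀ n, ContDiff ℝ 1 (v n) := fun n =>
    ((χ.contDiff.comp (contDiff_const_smul (c n))).smul (u.smooth 1))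
  have hvs : ∀ n, HasCompactSupport (v n) := fun n =>
    (χ.hasCompactSupport.comp_smul (hc n).ne').smul_right
  have hχle : ∀ y, ‖χ y‖ ≤ 1 := fun y => by
    rw [Real.norm_of_nonneg χ.nonneg]; exact χ.le_one
  have hder : ∀ n x, ‖fderiv ℝ (v n) x‖ ≤ ‖fderiv ℝ u x‖ + (c n * K) * ‖u x‖ := by
    intro n x
    have h1 : HasFDerivAt (fun x => χ (c n • x))
        ((fderiv ℝ χ (c n • x)).comp (c n • ContinuousLinearMap.id ℝ E)) x := by
      have h2 : HasFDerivAt χ (fderiv ℝ χ (c n • x)) (c n • x) :=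
        ((χ.contDiff (n := 1)).differentiable one_ne_zero _).hasFDerivAt
      exact h2.comp x ((hasFDerivAt_id x).const_smul (c n))
    have h3 := (h1.smul (u.differentiableAt (x := x)).hasFDerivAt).fderiv
    change ‖fderiv ℝ ((fun y => χ (c n • y)) • ⇑u) x‖ ≤ _
    rw [h3]
    refine (norm_add_le _ _).trans (add_le_add ?_ ?_)
    · rw [norm_smul]
      exact mul_le_of_le_one_left (norm_nonneg _) (hχle _)
    · rw [ContinuousLinearMap.norm_smulRight_apply]
      gcongr
      rw [ContinuousLinearMap.comp_smul, ContinuousLinearMap.comp_id, norm_smul,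
        Real.norm_of_nonneg (hc n).le]
      gcongr
      exact hK _
  have hbound : ∀ n, eLpNorm (v n) 6 volume ≤
      C * (eLpNorm (fderiv ℝ u) 2 volume + ENNReal.ofReal (c n * K) * eLpNorm u 2 volume) := by
    intro n
    have h1 := eLpNorm_le_eLpNorm_fderiv_of_eq (F := F) (volume : Measure E) (hv n) (hvs n)
      (p := 2) (p' := 6) one_le_two (by rw [hE]; norm_num) (by rw [hE]; norm_num)
    simp only [ENNReal.coe_ofNat, NNReal.coe_ofNat] at h1
    refine h1.trans ?_
    gcongr
    have hm1 : AEStronglyMeasurable (fun x => ‖fderiv ℝ u x‖) volume :=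
      ((u.smooth 1).continuous_fderiv one_ne_zero).norm.aestronglyMeasurable
    have hm2 : AEStronglyMeasurable ((c n * K) • fun x => ‖u x‖) volume :=
      (u.continuous.norm.const_smul _).aestronglyMeasurable
    calc eLpNorm (fderiv ℝ (v n)) 2 volume
        ≤ eLpNorm ((fun x => ‖fderiv ℝ u x‖) + (c n * K) • fun x => ‖u x‖) 2 volume :=
          eLpNorm_mono_real (hder n)
      _ ≤ _ := eLpNorm_add_le hm1 hm2 one_le_two
      _ = _ := by
          rw [eLpNorm_const_smul, eLpNorm_norm, eLpNorm_norm,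
            Real.enorm_of_nonneg (by have := hc n; positivity)]
  have hlim : ∀ x, Tendsto (fun n => v n x) atTop (𝓝 (u x)) := by
    intro x
    have h1 : Tendsto (fun n => χ (c n • x)) atTop (𝓝 (χ 0)) := by
      refine (χ.continuous.tendsto 0).comp ?_
      simpa using hc0.smul_const x
    have h2 : χ 0 = 1 := χ.one_of_mem_closedBall (Metric.mem_closedBall_self χ.rIn_pos.le)
    simpa [h2] using h1.smul_const (u x)
  have h2top : eLpNorm u 2 volume ≠ ⊤ := (u.memLp 2 volume).eLpNorm_ne_top
  have hRHS : Tendsto (fun n => (C : ℝ≥0∞) * (eLpNorm (fderiv ℝ u) 2 volume +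
      ENNReal.ofReal (c n * K) * eLpNorm u 2 volume)) atTop
      (𝓝 (C * (eLpNorm (fderiv ℝ u) 2 volume))) := by
    have h1 : Tendsto (fun n => ENNReal.ofReal (c n * K)) atTop (𝓝 0) := by
      have := (ENNReal.continuous_ofReal.tendsto 0).comp (by simpa using hc0.mul_const K)
      simpa [Function.comp_def] using this
    have h2 := ENNReal.Tendsto.mul_const h1 (Or.inr h2top)
    rw [zero_mul] at h2
    have h3 := ENNReal.Tendsto.const_mul (a := (C : ℝ≥0∞))
      (h2.const_add (eLpNorm (fderiv ℝ u) 2 volume)) (Or.inr ENNReal.coe_ne_top)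
    simpa using h3
  calc eLpNorm u 6 volume ≤ liminf (fun n => eLpNorm (v n) 6 volume) atTop :=
        Lp.eLpNorm_lim_le_liminf_eLpNorm (fun n => (hv n).continuous.aestronglyMeasurable) u
          (Eventually.of_forall hlim)
    _ ≤ liminf (fun n => (C : ℝ≥0∞) * (eLpNorm (fderiv ℝ u) 2 volume +
          ENNReal.ofReal (c n * K) * eLpNorm u 2 volume)) atTop :=
        liminf_le_liminf (Eventually.of_forall hbound)
    _ = _ := hRHS.liminf_eq

/-- A bounded operator on Euclidean space is controlled by its values on the standard basis. -/
theorem opNorm_le_sum_norm_apply_single {ι F : Type*} [Fintype ι] [DecidableEq ι]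
    [NormedAddCommGroup F] [NormedSpace ℝ F] (L : EuclideanSpace ℝ ι →L[ℝ] F) :
    ‖L‖ ≤ ∑ j, ‖L (EuclideanSpace.single j 1)‖ := by
  refine L.opNorm_le_bound (by positivity) fun x => ?_
  have hx : x = ∑ j, x j • EuclideanSpace.single j (1 : ℝ) := by
    simpa using ((EuclideanSpace.basisFun ι ℝ).sum_repr x).symm
  conv_lhs => rw [hx, map_sum]
  rw [Finset.sum_mul]
  refine (norm_sum_le _ _).trans (Finset.sum_le_sum fun j _ => ?_)
  rw [map_smul, norm_smul, mul_comm]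
  gcongr
  exact PiLp.norm_apply_le x j

/-- The Sobolev inequality `H¹(ℝ³) ⊂ L⁶(ℝ³)`. -/
theorem exists_eLpNorm_six_le_sum_weakPartial : ∃ C : ℝ≥0, ∀ f : sobolevH1,
    eLpNorm (f : SpinorL2) 6 volume ≤ C * ENNReal.ofReal (∑ j, ‖weakPartial j f‖) := by
  refine ⟨SNormLESNormFDerivOfEqConst Spinor (volume : Measure Space3) 2, fun f => ?_⟩
  set C : ℝ≥0 := SNormLESNormFDerivOfEqConst Spinor (volume : Measure Space3) 2
  obtain ⟨φ, hφ, hφd⟩ := exists_schwartz_tendsto_of_memSobolev_one f.2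
  have hφ6 : ∀ n, eLpNorm ((φ n).toLp 2 volume) 6 volume ≤
      (C : ℝ≥0∞) * ENNReal.ofReal (∑ j : Fin 3, ‖(∂_{EuclideanSpace.single j (1 : ℝ)} (φ n) :
        𝓢(Space3, Spinor)).toLp 2 volume‖) := by
    intro n
    rw [eLpNorm_congr_ae ((φ n).coeFn_toLp 2 volume)]
    refine (eLpNorm_six_le_eLpNorm_fderiv (by simp) (φ n)).trans ?_
    gcongr
    calc eLpNorm (fderiv ℝ (φ n)) 2 volume
        ≤ eLpNorm (∑ j, fun x => ‖(∂_{EuclideanSpace.single j (1 : ℝ)} (φ n) :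
            𝓢(Space3, Spinor)) x‖) 2 volume := by
          refine eLpNorm_mono_real fun x => ?_
          rw [Finset.sum_apply]
          exact opNorm_le_sum_norm_apply_single _
      _ ≤ ∑ j, eLpNorm (fun x => ‖(∂_{EuclideanSpace.single j (1 : ℝ)} (φ n) :
            𝓢(Space3, Spinor)) x‖) 2 volume :=
          eLpNorm_sum_le (fun j _ => (SchwartzMap.continuous _).norm.aestronglyMeasurable)
            one_le_two
      _ = _ := by
          rw [ENNReal.ofReal_sum_of_nonneg (fun _ _ => norm_nonneg _)]
          refine Finset.sum_congr rfl fun j _ => ?_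
          rw [eLpNorm_norm, SchwartzMap.norm_toLp, ENNReal.ofReal_toReal
            (SchwartzMap.memLp _ 2 volume).eLpNorm_ne_top]
  have hsum : Tendsto (fun n => (C : ℝ≥0∞) * ENNReal.ofReal
      (∑ j : Fin 3, ‖(∂_{EuclideanSpace.single j (1 : ℝ)} (φ n) : 𝓢(Space3, Spinor)).toLp 2 volume‖))
      atTop (𝓝 (C * ENNReal.ofReal (∑ j, ‖weakPartial j f‖))) := by
    refine ENNReal.Tendsto.const_mul ?_ (Or.inr ENNReal.coe_ne_top)
    refine (ENNReal.continuous_ofReal.tendsto _).comp ?_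
    exact tendsto_finsetSum _ fun j _ => (hφd _ _ (weakPartial_spec j f)).norm
  -- The $L^6$ norm is lower semicontinuous under convergence in measure, which follows from $L^2$
  -- convergence. The slack $\varepsilon$ turns the limit of the bounds into an eventual bound.
  refine ENNReal.le_of_forall_pos_le_add fun ε hε _ => ?_
  refine eLpNorm_le_of_tendstoInMeasure (u := atTop) ?_
    (tendstoInMeasure_of_tendsto_Lp hφ) (fun n => Lp.aestronglyMeasurable _)
  have hlt : (C * ENNReal.ofReal (∑ j, ‖weakPartial j f‖) : ℝ≥0∞) <
      C * ENNReal.ofReal (∑ j, ‖weakPartial j f‖) + ε :=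
    ENNReal.lt_add_right (ENNReal.mul_ne_top ENNReal.coe_ne_top ENNReal.ofReal_ne_top)
      (by exact_mod_cast hε.ne')
  filter_upwards [hsum.eventually (gt_mem_nhds hlt)] with n hn
  exact (hφ6 n).trans hn.le

end SobolevInequality

/-! ### Algebra of the Dirac matrices and of the symbol $\alpha\cdot p+m\beta$. -/

section DiracMatrices

open scoped InnerProductSpace

theorem diracAlpha_isSelfAdjoint (j : Fin 3) : IsSelfAdjoint (diracAlpha j) := by
  have h : IsSelfAdjoint (Matrix.fromBlocks 0 (pauliMatrix j) (pauliMatrix j) 0) := by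
    rw [isSelfAdjoint_iff, Matrix.star_eq_conjTranspose, Matrix.fromBlocks_conjTranspose]
    have : (pauliMatrix j).conjTranspose = pauliMatrix j := by
      ext a b
      fin_cases j <;> fin_cases a <;> fin_cases b <;> simp [pauliMatrix]
    rw [this, Matrix.conjTranspose_zero]
  exact h.map Matrix.toEuclideanCLM

theorem diracBeta_isSelfAdjoint : IsSelfAdjoint diracBeta := by
  have h : IsSelfAdjoint (Matrix.fromBlocks 1 0 0 (-1) : Matrix (Fin 2 ⊕ Fin 2) (Fin 2 ⊕ Fin 2) ℂ) := by
    rw [isSelfAdjoint_iff, Matrix.star_eq_conjTranspose, Matrix.fromBlocks_conjTranspose]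
    simp
  exact h.map Matrix.toEuclideanCLM

theorem pauliMatrix_mul_self (j : Fin 3) : pauliMatrix j * pauliMatrix j = 1 := by
  ext a b
  fin_cases j <;> fin_cases a <;> fin_cases b <;> simp [pauliMatrix, Matrix.mul_apply]

theorem pauliMatrix_mul_of_ne {j k : Fin 3} (h : j ≠ k) :
    pauliMatrix j * pauliMatrix k = -(pauliMatrix k * pauliMatrix j) := by
  ext a b
  fin_cases j <;> fin_cases k <;> first | exact absurd rfl h | skip
  all_goals fin_cases a <;> fin_cases b <;> simp [pauliMatrix, Matrix.mul_apply]

theorem diracAlpha_mul_self (j : Fin 3) : diracAlpha j * diracAlpha j = 1 := by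
  rw [diracAlpha, ← map_mul, Matrix.fromBlocks_multiply, pauliMatrix_mul_self]
  simp

theorem diracAlpha_mul_of_ne {j k : Fin 3} (h : j ≠ k) :
    diracAlpha j * diracAlpha k = -(diracAlpha k * diracAlpha j) := by
  rw [diracAlpha, diracAlpha, ← map_mul, ← map_mul, ← map_neg, Matrix.fromBlocks_multiply,
    Matrix.fromBlocks_multiply, pauliMatrix_mul_of_ne h, Matrix.fromBlocks_neg]
  simp

theorem diracBeta_mul_self : diracBeta * diracBeta = 1 := by
  rw [diracBeta, ← map_mul, Matrix.fromBlocks_multiply]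
  simp

theorem diracAlpha_mul_diracBeta (j : Fin 3) :
    diracAlpha j * diracBeta = -(diracBeta * diracAlpha j) := by
  rw [diracAlpha, diracBeta, ← map_mul, ← map_mul, ← map_neg, Matrix.fromBlocks_multiply,
    Matrix.fromBlocks_multiply, Matrix.fromBlocks_neg]
  simp

theorem inner_apply_left_of_isSelfAdjoint {L : Spinor →L[ℂ] Spinor} (hL : IsSelfAdjoint L)
    (u v : Spinor) : ⟪L u, v⟫_ℂ = ⟪u, L v⟫_ℂ :=
  (ContinuousLinearMap.isSelfAdjoint_iff_isSymmetric.mp hL) u v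

theorem norm_apply_of_isSelfAdjoint_of_mul_self {L : Spinor →L[ℂ] Spinor} (hL : IsSelfAdjoint L)
    {c : ℝ} (h : L * L = (c : ℂ) • 1) (v : Spinor) : ‖L v‖ ^ 2 = c * ‖v‖ ^ 2 := by
  have h1 : ⟪L v, L v⟫_ℂ = c * ⟪v, v⟫_ℂ := by
    rw [inner_apply_left_of_isSelfAdjoint hL, ← mul_apply_eq_comp, h]
    simp
  rw [inner_self_eq_norm_sq_to_K, inner_self_eq_norm_sq_to_K] at h1
  refine Complex.ofReal_injective ?_
  simpa using h1

theorem norm_diracAlpha_apply (j : Fin 3) (v : Spinor) : ‖diracAlpha j v‖ = ‖v‖ := by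
  have h := norm_apply_of_isSelfAdjoint_of_mul_self (c := 1) (diracAlpha_isSelfAdjoint j)
    (by simp [diracAlpha_mul_self]) v
  rw [one_mul] at h
  exact (sq_eq_sq₀ (norm_nonneg _) (norm_nonneg _)).mp h

theorem norm_diracBeta_apply (v : Spinor) : ‖diracBeta v‖ = ‖v‖ := by
  have h := norm_apply_of_isSelfAdjoint_of_mul_self (c := 1) diracBeta_isSelfAdjoint
    (by simp [diracBeta_mul_self]) v
  rw [one_mul] at h
  exact (sq_eq_sq₀ (norm_nonneg _) (norm_nonneg _)).mp h

/-- The symbol `α · p + m β` of the free Dirac operator. -/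
noncomputable def diracSymbol (m : ℝ) (p : Fin 3 → ℝ) : Spinor →L[ℂ] Spinor :=
  ∑ j, (p j : ℂ) • diracAlpha j + (m : ℂ) • diracBeta

theorem diracSymbol_apply (m : ℝ) (p : Fin 3 → ℝ) (v : Spinor) :
    diracSymbol m p v = ∑ j, (p j : ℂ) • diracAlpha j v + (m : ℂ) • diracBeta v := by
  simp [diracSymbol]

theorem diracSymbol_isSelfAdjoint (m : ℝ) (p : Fin 3 → ℝ) : IsSelfAdjoint (diracSymbol m p) := by
  have h : ∀ (r : ℝ) {L : Spinor →L[ℂ] Spinor}, IsSelfAdjoint L → IsSelfAdjoint ((r : ℂ) • L) :=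
    fun r L hL => IsSelfAdjoint.smul (Complex.conj_ofReal r) hL
  rw [diracSymbol]
  refine IsSelfAdjoint.add (isSelfAdjoint_sum (R := Spinor →L[ℂ] Spinor) _ fun j _ => ?_) ?_
  · exact h _ (diracAlpha_isSelfAdjoint j)
  · exact h m diracBeta_isSelfAdjoint

/-- The Clifford relations: distinct generators anticommute, so the mixed terms cancel, and each
generator squares to one. -/
theorem diracSymbol_mul_self (m : ℝ) (p : Fin 3 → ℝ) :
    diracSymbol m p * diracSymbol m p = ((∑ j, p j ^ 2 + m ^ 2 : ℝ) : ℂ) • 1 := by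
  have h10 := diracAlpha_mul_of_ne (j := 1) (k := 0) (by decide)
  have h20 := diracAlpha_mul_of_ne (j := 2) (k := 0) (by decide)
  have h21 := diracAlpha_mul_of_ne (j := 2) (k := 1) (by decide)
  simp only [diracSymbol, Fin.sum_univ_three, add_mul, mul_add, smul_mul_smul_comm,
    diracAlpha_mul_self, diracBeta_mul_self, diracAlpha_mul_diracBeta, h10, h20, h21]
  push_cast
  module

theorem norm_diracSymbol_apply_sq (m : ℝ) (p : Fin 3 → ℝ) (v : Spinor) :
    ‖diracSymbol m p v‖ ^ 2 = (∑ j, p j ^ 2 + m ^ 2) * ‖v‖ ^ 2 :=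
  norm_apply_of_isSelfAdjoint_of_mul_self (diracSymbol_isSelfAdjoint m p)
    (diracSymbol_mul_self m p) v

/-- The symbol $P$ is Hermitian, so $\langle Pv,v\rangle$ is real and its cross term with $i\mu v$
has real part zero. Only the two squares remain. -/
theorem norm_diracSymbol_sub_apply_sq (m μ : ℝ) (p : Fin 3 → ℝ) (v : Spinor) :
    ‖diracSymbol m p v - (μ * Complex.I) • v‖ ^ 2 = (∑ j, p j ^ 2 + m ^ 2 + μ ^ 2) * ‖v‖ ^ 2 := by
  have him : (⟪diracSymbol m p v, v⟫_ℂ).im = 0 := by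
    have h := inner_apply_left_of_isSelfAdjoint (diracSymbol_isSelfAdjoint m p) v v
    rw [← inner_conj_symm v] at h
    exact Complex.conj_eq_iff_im.mp h.symm
  rw [@norm_sub_sq ℂ, inner_smul_right, norm_diracSymbol_apply_sq, norm_smul]
  have : RCLike.re (μ * Complex.I * ⟪diracSymbol m p v, v⟫_ℂ) = 0 := by simp [him]
  rw [this]
  simp [mul_pow]
  ring

/-- `(P - iμ)(P + iμ) = |p|² + m² + μ²` for the Dirac symbol `P`. -/
theorem diracSymbol_sub_apply_add (m μ : ℝ) (p : Fin 3 → ℝ) (v : Spinor) :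
    diracSymbol m p (diracSymbol m p v + (μ * Complex.I) • v) -
      (μ * Complex.I) • (diracSymbol m p v + (μ * Complex.I) • v) =
      ((∑ j, p j ^ 2 + m ^ 2 + μ ^ 2 : ℝ) : ℂ) • v := by
  rw [map_add, map_smul, ← mul_apply_eq_comp, diracSymbol_mul_self, smul_add, smul_smul]
  have : (μ * Complex.I * (μ * Complex.I) : ℂ) = -((μ ^ 2 : ℝ) : ℂ) := by
    push_cast
    linear_combination (μ ^ 2 : ℂ) * Complex.I_mul_I
  rw [this]
  simp only [Complex.ofReal_add, smul_apply, one_apply_eq_self]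
  module

end DiracMatrices

/-! ### The free Dirac operator: symmetry, gradient bound, bijectivity of $H_0-i\mu$. -/

section FreeDirac

open FourierTransform Filter Topology
open scoped InnerProductSpace

theorem freeDirac_apply (m : ℝ) (f : sobolevH1) :
    freeDirac m f = ∑ j : Fin 3, (-Complex.I) • (diracAlpha j).compLpL 2 volume (weakPartial j f) +
      (m : ℂ) • diracBeta.compLpL 2 volume (f : SpinorL2) := by
  change ((∑ j : Fin 3, (-Complex.I) •
      ((diracAlpha j).compLpL 2 (volume : Measure Space3)).toLinearMap ∘ₗ weakPartial j) +
    (m : ℂ) • (diracBeta.compLpL 2 (volume : Measure Space3)).toLinearMap ∘ₗ sobolevH1.subtype) f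
      = _
  simp
  rfl

theorem fourier_weakPartial_ae (j : Fin 3) (f : sobolevH1) :
    (𝓕 (weakPartial j f) : SpinorL2) =ᵐ[volume]
      fun ξ => (Complex.I * (2 * Real.pi * ξ j : ℝ)) • (𝓕 (f : SpinorL2) : SpinorL2) ξ := by
  filter_upwards [fourier_ae_eq_of_lineDerivOp_eq (weakPartial_spec j f)] with ξ hξ
  have h : (inner ℝ ξ (EuclideanSpace.single j (1 : ℝ)) : ℝ) = ξ j := by
    simp [EuclideanSpace.inner_single_right]
  rw [hξ, h]
  congr 1
  push_cast
  ring

theorem coeFn_sum_smul_compLpL_add (c : Fin 3 → ℂ) (d : ℂ) (L : Fin 3 → Spinor →L[ℂ] Spinor)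
    (M : Spinor →L[ℂ] Spinor) (f : Fin 3 → SpinorL2) (g : SpinorL2) :
    (∑ j, c j • (L j).compLpL 2 volume (f j) + d • M.compLpL 2 volume g : SpinorL2) =ᵐ[volume]
      fun x => ∑ j, c j • L j (f j x) + d • M (g x) := by
  have h1 : ∀ᵐ x, ∀ j, (c j • (L j).compLpL 2 volume (f j) : SpinorL2) x = c j • L j (f j x) := by
    refine ae_all_iff.mpr fun j => ?_
    filter_upwards [Lp.coeFn_smul (c j) ((L j).compLpL 2 volume (f j)),
      (L j).coeFn_compLpL (f j)] with x hx1 hx2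
    rw [hx1, Pi.smul_apply, hx2]
  filter_upwards [h1, Lp.coeFn_add (∑ j, c j • (L j).compLpL 2 volume (f j))
    (d • M.compLpL 2 volume g), Lp.coeFn_finsetSum Finset.univ
      (fun j => c j • (L j).compLpL 2 volume (f j)), Lp.coeFn_smul d (M.compLpL 2 volume g),
    M.coeFn_compLpL g] with x hx1 hx2 hx3 hx4 hx5
  rw [hx2, Pi.add_apply, hx3, hx4, Pi.smul_apply, hx5, Finset.sum_apply]
  simp only [hx1]

/-- The Fourier transform turns the free Dirac operator into multiplication by its symbol. -/
theorem fourier_freeDirac_ae (m : ℝ) (f : sobolevH1) :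
    (𝓕 (freeDirac m f) : SpinorL2) =ᵐ[volume]
      fun ξ => diracSymbol m (fun j => 2 * Real.pi * ξ j) ((𝓕 (f : SpinorL2) : SpinorL2) ξ) := by
  have hlin : (𝓕 (freeDirac m f) : SpinorL2) =
      ∑ j : Fin 3, (-Complex.I) • (diracAlpha j).compLpL 2 volume (𝓕 (weakPartial j f)) +
        (m : ℂ) • diracBeta.compLpL 2 volume (𝓕 (f : SpinorL2)) := by
    change Lp.fourierTransformₗᵢ Space3 Spinor (freeDirac m f) = _
    rw [freeDirac_apply, map_add, map_sum, map_smul]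
    simp only [map_smul]
    simp only [← fourier_compLpL]
    rfl
  rw [hlin]
  filter_upwards [coeFn_sum_smul_compLpL_add (fun _ => -Complex.I) m diracAlpha diracBeta
    (fun j => 𝓕 (weakPartial j f)) (𝓕 (f : SpinorL2)),
    ae_all_iff.mpr fun j => fourier_weakPartial_ae j f] with ξ h1 h2
  rw [h1, diracSymbol_apply]
  congr 1
  refine Finset.sum_congr rfl fun j _ => ?_
  rw [h2, map_smul, smul_smul]
  congr 1
  linear_combination (-(2 * Real.pi * ξ j : ℝ) : ℂ) * Complex.I_mul_I

theorem fourier_freeDirac_sub_smul_ae (m : ℝ) (z : ℂ) (f : sobolevH1) :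
    (𝓕 (freeDirac m f - z • (f : SpinorL2)) : SpinorL2) =ᵐ[volume]
      fun ξ => diracSymbol m (fun j => 2 * Real.pi * ξ j) ((𝓕 (f : SpinorL2) : SpinorL2) ξ) -
        z • (𝓕 (f : SpinorL2) : SpinorL2) ξ := by
  have hlin : (𝓕 (freeDirac m f - z • (f : SpinorL2)) : SpinorL2) =
      𝓕 (freeDirac m f) - z • 𝓕 (f : SpinorL2) := by
    change Lp.fourierTransformₗᵢ Space3 Spinor _ = _
    rw [map_sub, map_smul]
    rfl
  rw [hlin]
  filter_upwards [fourier_freeDirac_ae m f, Lp.coeFn_sub (𝓕 (freeDirac m f)) (z • 𝓕 (f : SpinorL2)),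
    Lp.coeFn_smul z (𝓕 (f : SpinorL2))] with ξ h1 h2 h3
  rw [h2, Pi.sub_apply, h1, h3, Pi.smul_apply]

/-- By Plancherel this is the pointwise Hermiticity of the symbol. -/
theorem freeDirac_isFormalAdjoint (m : ℝ) : (freeDirac m).IsFormalAdjoint (freeDirac m) := by
  intro f g
  rw [← Lp.inner_fourier_eq, ← Lp.inner_fourier_eq (f : SpinorL2), L2.inner_def, L2.inner_def]
  refine integral_congr_ae ?_
  filter_upwards [fourier_freeDirac_ae m f, fourier_freeDirac_ae m g] with ξ h1 h2
  rw [h1, h2]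
  exact inner_apply_left_of_isSelfAdjoint (diracSymbol_isSelfAdjoint _ _) _ _

/-- The partial derivatives are bounded relative to the free Dirac operator. -/
theorem norm_weakPartial_le (m μ : ℝ) (j : Fin 3) (f : sobolevH1) :
    ‖weakPartial j f‖ ≤ ‖freeDirac m f - (μ * Complex.I) • (f : SpinorL2)‖ := by
  rw [← Lp.norm_fourier_eq, ← Lp.norm_fourier_eq (_ - _)]
  refine Lp.norm_le_norm_of_ae_le ?_
  filter_upwards [fourier_weakPartial_ae j f, fourier_freeDirac_sub_smul_ae m (μ * Complex.I) f]
    with ξ h1 h2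
  -- After squaring, the claim is $(2\pi\xi_j)^2\le|2\pi\xi|^2+m^2+\mu^2$ times $|\hat f(\xi)|^2$.
  refine le_of_sq_le_sq ?_ (norm_nonneg _)
  rw [h1, h2, norm_diracSymbol_sub_apply_sq, norm_smul, norm_mul, Complex.norm_I, one_mul,
    Complex.norm_real, mul_pow, Real.norm_eq_abs, sq_abs]
  gcongr
  have := Finset.single_le_sum (f := fun j => (2 * Real.pi * ξ j) ^ 2)
    (fun i _ => sq_nonneg _) (Finset.mem_univ j)
  simp only at this
  nlinarith [sq_nonneg m, sq_nonneg μ]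

theorem sum_two_pi_mul_sq (ξ : Space3) :
    ∑ j, (2 * Real.pi * ξ j) ^ 2 = (2 * Real.pi) ^ 2 * ‖ξ‖ ^ 2 := by
  rw [EuclideanSpace.norm_sq_eq, Finset.mul_sum]
  exact Finset.sum_congr rfl fun j _ => by rw [mul_pow, Real.norm_eq_abs, sq_abs]

/-- For `μ ≠ 0` the operator `H₀ - iμ` maps `[H¹]⁴` onto `[L²]⁴`. -/
theorem exists_freeDirac_sub_eq (m : ℝ) {μ : ℝ} (hμ : μ ≠ 0) (g : SpinorL2) :
    ∃ f : sobolevH1, freeDirac m f - (μ * Complex.I) • (f : SpinorL2) = g := by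
  set G : SpinorL2 := 𝓕 g with hG
  let N : Space3 → ℝ := fun ξ => ∑ j, (2 * Real.pi * ξ j) ^ 2 + m ^ 2 + μ ^ 2
  let P : Space3 → Spinor →L[ℂ] Spinor := fun ξ => diracSymbol m (fun j => 2 * Real.pi * ξ j)
  have hN : ∀ ξ, N ξ = (2 * Real.pi) ^ 2 * ‖ξ‖ ^ 2 + m ^ 2 + μ ^ 2 := fun ξ => by
    simp only [N, sum_two_pi_mul_sq]
  have hμ2 : 0 < μ ^ 2 := by positivity
  have hNpos : ∀ ξ, 0 < N ξ := fun ξ => by rw [hN]; positivity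
  -- $u=(P-i\mu)^{-1}G$, written with $(P-i\mu)(P+i\mu)=N$.
  let u : Space3 → Spinor := fun ξ => ((N ξ)⁻¹ : ℂ) • (P ξ (G ξ) + (μ * Complex.I) • G ξ)
  have husq : ∀ ξ, N ξ * ‖u ξ‖ ^ 2 = ‖G ξ‖ ^ 2 := by
    intro ξ
    have h := norm_diracSymbol_sub_apply_sq m (-μ) (fun j => 2 * Real.pi * ξ j) (G ξ)
    have h2 : ‖P ξ (G ξ) + (μ * Complex.I) • G ξ‖ ^ 2 = N ξ * ‖G ξ‖ ^ 2 := by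
      simpa [N, P] using h
    simp only [u]
    rw [norm_smul, mul_pow, h2, norm_inv, Complex.norm_real, Real.norm_of_nonneg (hNpos ξ).le]
    have := (hNpos ξ).ne'
    field_simp
  have hPc : Continuous P := by
    simp only [P, diracSymbol]
    fun_prop
  have hNc : Continuous N := by
    simp only [N]
    fun_prop
  have hGm : AEStronglyMeasurable G volume := Lp.aestronglyMeasurable G
  have hum : AEStronglyMeasurable u volume := by
    have h1 : AEStronglyMeasurable (fun ξ => P ξ (G ξ)) volume :=
      (ContinuousLinearMap.apply ℂ Spinor).flip.aestronglyMeasurable_comp₂ hPc.aestronglyMeasurable hGm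
    have h2 : AEStronglyMeasurable (fun ξ => (N ξ : ℂ)⁻¹) (volume : Measure Space3) :=
      (Continuous.inv₀ (Complex.continuous_ofReal.comp hNc)
        fun ξ => Complex.ofReal_ne_zero.mpr (hNpos ξ).ne').aestronglyMeasurable
    exact h2.smul (h1.add (hGm.const_smul (μ * Complex.I : ℂ)))
  -- The constant comes from $1+|\xi|^2\le(1+\mu^{-2})N$, which holds because $N\ge|\xi|^2$ and
  -- $N\ge\mu^2$. This estimate gives both $u\in L^2$ and the $H^1$ regularity of its inverse
  -- Fourier transform.
  have hwsq : ∀ ξ, (1 + ‖ξ‖ ^ 2) * ‖u ξ‖ ^ 2 ≤ ((1 + (μ ^ 2)⁻¹) * ‖G ξ‖) ^ 2 := by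
    intro ξ
    have h1 : 1 + ‖ξ‖ ^ 2 ≤ (1 + (μ ^ 2)⁻¹) * N ξ := by
      have h2 : ‖ξ‖ ^ 2 ≤ (2 * Real.pi) ^ 2 * ‖ξ‖ ^ 2 :=
        le_mul_of_one_le_left (by positivity) (by nlinarith [Real.pi_gt_three])
      have h3 : (μ ^ 2)⁻¹ * μ ^ 2 = 1 := inv_mul_cancel₀ hμ2.ne'
      have h4 : 0 ≤ (μ ^ 2)⁻¹ * ((2 * Real.pi) ^ 2 * ‖ξ‖ ^ 2 + m ^ 2) := by positivity
      rw [hN]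
      nlinarith [sq_nonneg m]
    have h5 : 1 ≤ 1 + (μ ^ 2)⁻¹ := by simp [sq_nonneg]
    calc (1 + ‖ξ‖ ^ 2) * ‖u ξ‖ ^ 2 ≤ (1 + (μ ^ 2)⁻¹) * N ξ * ‖u ξ‖ ^ 2 := by gcongr
      _ = (1 + (μ ^ 2)⁻¹) * ‖G ξ‖ ^ 2 := by rw [mul_assoc, husq]
      _ ≤ (1 + (μ ^ 2)⁻¹) ^ 2 * ‖G ξ‖ ^ 2 := by
        gcongr; exact le_self_pow₀ h5 two_ne_zero
      _ = _ := by rw [mul_pow]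
  have hu : MemLp u 2 volume := by
    refine (Lp.memLp G).of_le_mul (c := 1 + (μ ^ 2)⁻¹) hum (Eventually.of_forall fun ξ => ?_)
    refine le_of_sq_le_sq ((le_mul_of_one_le_left (sq_nonneg _) ?_).trans (hwsq ξ)) (by positivity)
    linarith [sq_nonneg ‖ξ‖]
  have hw : MemLp (fun ξ => (((1 + ‖ξ‖ ^ 2) ^ ((1 : ℝ) / 2) : ℝ) : ℂ) • u ξ) 2 volume := by
    refine (Lp.memLp G).of_le_mul (c := 1 + (μ ^ 2)⁻¹) ?_ (Eventually.of_forall fun ξ => ?_)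
    · have : (fun ξ : Space3 => (((1 + ‖ξ‖ ^ 2) ^ ((1 : ℝ) / 2) : ℝ) : ℂ)).HasTemperateGrowth := by
        fun_prop
      exact this.1.continuous.aestronglyMeasurable.smul hum
    · refine le_of_sq_le_sq (le_trans (le_of_eq ?_) (hwsq ξ)) (by positivity)
      rw [norm_smul, mul_pow, Complex.norm_real, Real.norm_of_nonneg (by positivity),
        ← Real.rpow_natCast, ← Real.rpow_mul (by positivity)]
      norm_num
  let f : SpinorL2 := 𝓕⁻ (hu.toLp u)
  have hf : (𝓕 f : SpinorL2) = hu.toLp u := FourierTransform.fourier_fourierInv_eq _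
  have hfmem : f ∈ sobolevH1 := by
    refine (memSobolev_one_iff_exists_ae_eq f).mpr ⟨hw.toLp _, ?_⟩
    filter_upwards [hw.coeFn_toLp, hu.coeFn_toLp] with ξ h1 h2
    rw [h1, hf, h2]
  refine ⟨⟨f, hfmem⟩, (Lp.fourierTransformₗᵢ Space3 Spinor).injective ?_⟩
  refine Lp.ext ?_
  change (𝓕 (freeDirac m ⟨f, hfmem⟩ - (μ * Complex.I) • f) : SpinorL2) =ᵐ[volume] G
  filter_upwards [fourier_freeDirac_sub_smul_ae m (μ * Complex.I) ⟨f, hfmem⟩, hu.coeFn_toLp]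
    with ξ h1 h2
  have h3 : (𝓕 f : SpinorL2) ξ = u ξ := by rw [hf, h2]
  have h4 := diracSymbol_sub_apply_add m μ (fun j => 2 * Real.pi * ξ j) (G ξ)
  have h5 : (N ξ : ℂ) ≠ 0 := by exact_mod_cast (hNpos ξ).ne'
  refine h1.trans ?_
  rw [h3]
  simp only [u]
  rw [map_smul, smul_comm (μ * Complex.I : ℂ) ((N ξ : ℂ)⁻¹), ← smul_sub]
  refine (congrArg _ h4).trans ?_
  exact inv_smul_smul₀ h5 _

/-- The operator `H₀ - z` as a linear map on `[H¹]⁴`. -/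
noncomputable def freeDiracSub (m : ℝ) (z : ℂ) : sobolevH1 →ₗ[ℂ] SpinorL2 :=
  (show sobolevH1 →ₗ[ℂ] SpinorL2 from (freeDirac m).toFun) - z • sobolevH1.subtype

theorem freeDiracSub_apply (m : ℝ) (z : ℂ) (f : sobolevH1) :
    freeDiracSub m z f = freeDirac m f - z • (f : SpinorL2) := rfl

/-- For `μ ≠ 0` the operator `H₀ - iμ` is a bijection of `[H¹]⁴` onto `[L²]⁴`. -/
theorem freeDiracSub_bijective (m : ℝ) {μ : ℝ} (hμ : μ ≠ 0) :
    Function.Bijective (freeDiracSub m (μ * Complex.I)) := by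
  refine ⟨?_, exists_freeDirac_sub_eq m hμ⟩
  refine (injective_iff_map_eq_zero _).mpr fun f hf => ?_
  have h := abs_im_mul_norm_le_of_isFormalAdjoint (freeDirac_isFormalAdjoint m) (μ * Complex.I) f
  have h2 : freeDirac m f - (μ * Complex.I) • (f : SpinorL2) = 0 := hf
  rw [h2, norm_zero] at h
  have h3 : 0 < |(μ * Complex.I).im| := by simpa using hμ
  exact Subtype.ext (norm_eq_zero.mp (le_antisymm (nonpos_of_mul_nonpos_right h h3) (norm_nonneg _)))

end FreeDirac

/-! ### Relative bounds for the potential, the domain of $H_A$ and its self-adjointness. -/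

section Potential

open Filter Topology
open scoped InnerProductSpace ENNReal NNReal

theorem holderTriple_three_six_two : ENNReal.HolderTriple 3 6 2 := by
  constructor
  rw [← ENNReal.toReal_eq_toReal_iff' (by simp) (by simp), ENNReal.toReal_add (by simp) (by simp)]
  simp only [ENNReal.toReal_inv, ENNReal.toReal_ofNat]
  norm_num

/-- Hölder's inequality for the product of an `L³` and an `L⁶` function. -/
theorem eLpNorm_two_smul_le {a : Space3 → ℝ} (ha : AEStronglyMeasurable a volume)
    {f : Space3 → Spinor} (hf : AEStronglyMeasurable f volume) :
    eLpNorm (fun x => (a x : ℂ) • f x) 2 volume ≤ eLpNorm a 3 volume * eLpNorm f 6 volume := by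
  have := holderTriple_three_six_two
  have h : (fun x => (a x : ℂ) • f x) = a • f := by
    funext x; simp
  rw [h]
  exact eLpNorm_smul_le_mul_eLpNorm hf ha

/-- Multiplication by an `L³` function is infinitesimally small relative to the gradient. -/
theorem exists_eLpNorm_smul_le_of_memLp_three {a : Space3 → ℝ} (ha : MemLp a 3 volume)
    {ε : ℝ} (hε : 0 < ε) : ∃ K : ℝ, 0 ≤ K ∧ ∀ f : sobolevH1,
      eLpNorm (fun x => (a x : ℂ) • (f : SpinorL2) x) 2 volume ≤
        ENNReal.ofReal (ε * ∑ j, ‖weakPartial j f‖ + K * ‖(f : SpinorL2)‖) := by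
  obtain ⟨C, hC⟩ := exists_eLpNorm_six_le_sum_weakPartial
  obtain ⟨b, hbm, hab⟩ := ha.1
  have hb : MemLp b 3 volume := (memLp_congr_ae hab).mp ha
  -- The part of `b` above the level `M` has small $L^3$ norm and is paired with the $L^6$ norm of
  -- `f`; the rest is bounded. Dividing by `C + 1` rather than `C` covers `C = 0`.
  obtain ⟨M, hM⟩ := hb.eLpNorm_indicator_norm_ge_le hbm (ε := ε / (C + 1)) (by positivity)
  set s : Set Space3 := {x | M ≤ ‖b x‖₊} with hs
  have hsm : MeasurableSet s :=
    measurableSet_le measurable_const hbm.nnnorm.measurable.subtype_coe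
  refine ⟨|M|, abs_nonneg _, fun f => ?_⟩
  have hfm := Lp.aestronglyMeasurable (f : SpinorL2)
  have hsplit : (fun x => (a x : ℂ) • (f : SpinorL2) x) =ᵐ[volume]
      (fun x => ((s.indicator b x : ℝ) : ℂ) • (f : SpinorL2) x) +
        fun x => ((sᶜ.indicator b x : ℝ) : ℂ) • (f : SpinorL2) x := by
    filter_upwards [hab] with x hx
    rw [hx, Pi.add_apply, ← add_smul, ← Complex.ofReal_add, ← Pi.add_apply,
      Set.indicator_self_add_compl]
  have hm1 : AEStronglyMeasurable (fun x => ((s.indicator b x : ℝ) : ℂ) • (f : SpinorL2) x)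
      volume :=
    (Complex.continuous_ofReal.comp_aestronglyMeasurable
      (hbm.indicator hsm).aestronglyMeasurable).smul hfm
  have hm2 : AEStronglyMeasurable (fun x => ((sᶜ.indicator b x : ℝ) : ℂ) • (f : SpinorL2) x)
      volume :=
    (Complex.continuous_ofReal.comp_aestronglyMeasurable
      (hbm.indicator hsm.compl).aestronglyMeasurable).smul hfm
  have hS : 0 ≤ ∑ j, ‖weakPartial j f‖ := Finset.sum_nonneg fun _ _ => norm_nonneg _
  rw [eLpNorm_congr_ae hsplit, ENNReal.ofReal_add (by positivity) (by positivity)]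
  refine (eLpNorm_add_le hm1 hm2 one_le_two).trans (add_le_add ?_ ?_)
  · refine (eLpNorm_two_smul_le (hbm.indicator hsm).aestronglyMeasurable hfm).trans ?_
    calc _ ≤ ENNReal.ofReal (ε / (C + 1)) * (C * ENNReal.ofReal (∑ j, ‖weakPartial j f‖)) :=
          mul_le_mul' hM (hC f)
      _ = ENNReal.ofReal (ε / (C + 1) * (C * ∑ j, ‖weakPartial j f‖)) := by
          rw [ENNReal.ofReal_mul (by positivity), ENNReal.ofReal_mul (by positivity),
            ENNReal.ofReal_coe_nnreal]
      _ ≤ _ := by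
          refine ENNReal.ofReal_le_ofReal ?_
          rw [← mul_assoc]
          refine mul_le_mul_of_nonneg_right ?_ hS
          rw [div_mul_eq_mul_div, div_le_iff₀ (by positivity)]
          nlinarith [C.coe_nonneg]
  · rw [ENNReal.ofReal_mul (abs_nonneg _), Lp.norm_def, ENNReal.ofReal_toReal (Lp.eLpNorm_ne_top _)]
    refine eLpNorm_le_mul_eLpNorm_of_ae_le_mul (Eventually.of_forall fun x => ?_) 2
    rw [norm_smul, Complex.norm_real]
    gcongr
    by_cases hx : x ∈ s
    · rw [Set.indicator_of_notMem (by simpa using hx), norm_zero]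
      exact abs_nonneg _
    · rw [Set.indicator_of_mem (by simpa using hx)]
      have : ‖b x‖ < M := by simpa [hs] using hx
      exact this.le.trans (le_abs_self M)

theorem aestronglyMeasurable_alphaDotMul {A : Fin 3 → Space3 → ℝ}
    (hA : ∀ j, MemLp (A j) 3 (volume : Measure Space3)) (f : SpinorL2) :
    AEStronglyMeasurable (alphaDotMul A f) volume := by
  have h : ∀ j, AEStronglyMeasurable (fun x => (A j x : ℂ) • diracAlpha j (f x)) volume := fun j =>
    (Complex.continuous_ofReal.comp_aestronglyMeasurable (hA j).1).smul
      ((diracAlpha j).continuous.comp_aestronglyMeasurable (Lp.aestronglyMeasurable f))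
  have hsum : alphaDotMul A f = ∑ j, fun x => (A j x : ℂ) • diracAlpha j (f x) := by
    funext x
    simp [alphaDotMul]
  rw [hsum]
  exact Finset.aestronglyMeasurable_sum Finset.univ fun j _ => h j

theorem eLpNorm_alphaDotMul_le {A : Fin 3 → Space3 → ℝ}
    (hA : ∀ j, MemLp (A j) 3 (volume : Measure Space3)) (f : SpinorL2) :
    eLpNorm (alphaDotMul A f) 2 volume ≤
      ∑ j, eLpNorm (fun x => (A j x : ℂ) • f x) 2 volume := by
  have h : ∀ j, AEStronglyMeasurable (fun x => (A j x : ℂ) • f x) volume := fun j =>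
    (Complex.continuous_ofReal.comp_aestronglyMeasurable (hA j).1).smul (Lp.aestronglyMeasurable f)
  calc eLpNorm (alphaDotMul A f) 2 volume
      ≤ eLpNorm (∑ j, fun x => ‖(A j x : ℂ) • f x‖) 2 volume := by
        refine eLpNorm_mono_real fun x => ?_
        rw [Finset.sum_apply]
        refine (norm_sum_le _ _).trans_eq (Finset.sum_congr rfl fun j _ => ?_)
        rw [norm_smul, norm_smul, norm_diracAlpha_apply]
    _ ≤ ∑ j, eLpNorm (fun x => ‖(A j x : ℂ) • f x‖) 2 volume :=
        eLpNorm_sum_le (fun j _ => (h j).norm) one_le_two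
    _ = _ := Finset.sum_congr rfl fun j _ => eLpNorm_norm _

/-- The magnetic potential is infinitesimally small relative to the gradient. -/
theorem exists_eLpNorm_alphaDotMul_le {A : Fin 3 → Space3 → ℝ}
    (hA : ∀ j, MemLp (A j) 3 (volume : Measure Space3)) {ε : ℝ} (hε : 0 < ε) :
    ∃ K : ℝ, 0 ≤ K ∧ ∀ f : sobolevH1, eLpNorm (alphaDotMul A (f : SpinorL2)) 2 volume ≤
      ENNReal.ofReal (ε * ∑ j, ‖weakPartial j f‖ + K * ‖(f : SpinorL2)‖) := by
  choose K hK0 hK using fun j =>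
    exists_eLpNorm_smul_le_of_memLp_three (hA j) (ε := ε / 3) (by positivity)
  refine ⟨∑ j, K j, Finset.sum_nonneg fun j _ => hK0 j, fun f => ?_⟩
  refine (eLpNorm_alphaDotMul_le hA f).trans ((Finset.sum_le_sum fun j _ => hK j f).trans_eq ?_)
  have hS : 0 ≤ ∑ j, ‖weakPartial j f‖ := Finset.sum_nonneg fun _ _ => norm_nonneg _
  rw [← ENNReal.ofReal_sum_of_nonneg fun j _ => by have := hK0 j; positivity]
  congr 1
  rw [Finset.sum_add_distrib, Finset.sum_mul, Finset.sum_const, Finset.card_univ,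
    Fintype.card_fin, nsmul_eq_mul]
  push_cast
  ring

theorem sobolevH1_le_magneticPotential_domain {A : Fin 3 → Space3 → ℝ}
    (hA : ∀ j, MemLp (A j) 3 (volume : Measure Space3)) :
    sobolevH1 ≤ (magneticPotential A).domain := by
  intro f hf
  -- Only finiteness of the bound matters here, so any $\varepsilon$ would do.
  obtain ⟨K, -, hK⟩ := exists_eLpNorm_alphaDotMul_le hA one_pos
  exact ⟨aestronglyMeasurable_alphaDotMul hA f, (hK ⟨f, hf⟩).trans_lt ENNReal.ofReal_lt_top⟩

theorem magneticDirac_domain (m : ℝ) {A : Fin 3 → Space3 → ℝ}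
    (hA : ∀ j, MemLp (A j) 3 (volume : Measure Space3)) :
    (magneticDirac m A).domain = sobolevH1 :=
  inf_eq_left.mpr (sobolevH1_le_magneticPotential_domain hA)

/-- The magnetic potential as a linear map on `[H¹]⁴`. -/
noncomputable def potentialOnH1 {A : Fin 3 → Space3 → ℝ}
    (hA : ∀ j, MemLp (A j) 3 (volume : Measure Space3)) : sobolevH1 →ₗ[ℂ] SpinorL2 :=
  (magneticPotential A).toFun ∘ₗ Submodule.inclusion (sobolevH1_le_magneticPotential_domain hA)

variable {A : Fin 3 → Space3 → ℝ} (hA : ∀ j, MemLp (A j) 3 (volume : Measure Space3))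

theorem coeFn_potentialOnH1 (f : sobolevH1) :
    potentialOnH1 hA f =ᵐ[volume] alphaDotMul A (f : SpinorL2) :=
  MemLp.coeFn_toLp (sobolevH1_le_magneticPotential_domain hA f.2)

theorem norm_potentialOnH1 (f : sobolevH1) :
    ‖potentialOnH1 hA f‖ = (eLpNorm (alphaDotMul A (f : SpinorL2)) 2 volume).toReal := by
  rw [Lp.norm_def, eLpNorm_congr_ae (coeFn_potentialOnH1 hA f)]

theorem exists_norm_potentialOnH1_le {ε : ℝ} (hε : 0 < ε) :
    ∃ K : ℝ, 0 ≤ K ∧ ∀ f : sobolevH1,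
      ‖potentialOnH1 hA f‖ ≤ ε * ∑ j, ‖weakPartial j f‖ + K * ‖(f : SpinorL2)‖ := by
  obtain ⟨K, hK0, hK⟩ := exists_eLpNorm_alphaDotMul_le hA hε
  refine ⟨K, hK0, fun f => ?_⟩
  rw [norm_potentialOnH1]
  exact ENNReal.toReal_le_of_le_ofReal (by positivity) (hK f)

/-- Hölder and Sobolev without splitting $A$: the gradient coefficient is no longer small, but the
term in $\|f\|$ disappears. This is what lets the potential become negligible on slowly varying
envelopes in the spectral argument. -/
theorem exists_norm_potentialOnH1_le_mul_sum_weakPartial :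
    ∃ K : ℝ, ∀ f : sobolevH1,
      ‖potentialOnH1 hA f‖ ≤ K * ∑ j, ‖weakPartial j f‖ := by
  obtain ⟨C, hC⟩ := exists_eLpNorm_six_le_sum_weakPartial
  refine ⟨(∑ j, (eLpNorm (A j) 3 volume).toReal) * C, fun f => ?_⟩
  rw [norm_potentialOnH1]
  have hS : 0 ≤ ∑ j, ‖weakPartial j f‖ := Finset.sum_nonneg fun _ _ => norm_nonneg _
  refine ENNReal.toReal_le_of_le_ofReal (by positivity) ?_
  refine (eLpNorm_alphaDotMul_le hA f).trans ?_
  rw [mul_assoc, Finset.sum_mul, ENNReal.ofReal_sum_of_nonneg fun _ _ => by positivity]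
  refine Finset.sum_le_sum fun j _ => ?_
  refine (eLpNorm_two_smul_le (hA j).1 (Lp.aestronglyMeasurable _)).trans ?_
  rw [ENNReal.ofReal_mul (by positivity), ENNReal.ofReal_toReal (hA j).eLpNorm_ne_top,
    ENNReal.ofReal_mul (by positivity), ENNReal.ofReal_coe_nnreal]
  gcongr
  exact hC f

theorem inner_potentialOnH1_left (f g : sobolevH1) :
    ⟪potentialOnH1 hA f, (g : SpinorL2)⟫_ℂ = ⟪(f : SpinorL2), potentialOnH1 hA g⟫_ℂ := by
  rw [L2.inner_def, L2.inner_def]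
  refine integral_congr_ae ?_
  filter_upwards [coeFn_potentialOnH1 hA f, coeFn_potentialOnH1 hA g] with x h1 h2
  rw [h1, h2, alphaDotMul, alphaDotMul, sum_inner, inner_sum]
  refine Finset.sum_congr rfl fun j _ => ?_
  rw [inner_smul_left, inner_smul_right, Complex.conj_ofReal,
    inner_apply_left_of_isSelfAdjoint (diracAlpha_isSelfAdjoint j)]

theorem magneticDirac_apply (m : ℝ) (f : (magneticDirac m A).domain) (hf : (f : SpinorL2) ∈ sobolevH1) :
    magneticDirac m A f = freeDirac m ⟨f, hf⟩ - potentialOnH1 hA ⟨f, hf⟩ := rfl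

theorem magneticDirac_isFormalAdjoint {A : Fin 3 → Space3 → ℝ}
    (hA : ∀ j, MemLp (A j) 3 (volume : Measure Space3)) (m : ℝ) :
    (magneticDirac m A).IsFormalAdjoint (magneticDirac m A) := by
  intro f g
  have hf : (f : SpinorL2) ∈ sobolevH1 := f.2.1
  have hg : (g : SpinorL2) ∈ sobolevH1 := g.2.1
  rw [magneticDirac_apply hA m f hf, magneticDirac_apply hA m g hg, inner_sub_left, inner_sub_right]
  congr 1
  · exact freeDirac_isFormalAdjoint m ⟨f, hf⟩ ⟨g, hg⟩
  · exact inner_potentialOnH1_left hA ⟨f, hf⟩ ⟨g, hg⟩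

theorem exists_norm_potentialOnH1_le_half_mul_norm (m : ℝ) : ∃ μ₀ : ℝ, 0 < μ₀ ∧ ∀ μ : ℝ,
    μ₀ ≤ |μ| → ∀ f : sobolevH1,
      ‖potentialOnH1 hA f‖ ≤ 1 / 2 * ‖freeDiracSub m (μ * Complex.I) f‖ := by
  -- Each of the three derivatives is bounded by $\|(H_0-i\mu)f\|$, so $1/12$ contributes
  -- $3/12=1/4$. The choice $|\mu|\ge4K+1$ makes $K\|f\|\le\frac14|\mu|\,\|f\|$ at most another
  -- $1/4$.
  obtain ⟨K, hK0, hK⟩ := exists_norm_potentialOnH1_le hA (ε := 1 / 12) (by norm_num)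
  refine ⟨4 * K + 1, by positivity, fun μ hKμ f => ?_⟩
  have h1 := hK f
  have h2 : ∑ j, ‖weakPartial j f‖ ≤ 3 * ‖freeDiracSub m (μ * Complex.I) f‖ := by
    refine (Finset.sum_le_sum fun j _ => norm_weakPartial_le m μ j f).trans_eq ?_
    rw [Finset.sum_const, Finset.card_univ, Fintype.card_fin, nsmul_eq_mul, freeDiracSub_apply]
    rfl
  have h3 := abs_im_mul_norm_le_of_isFormalAdjoint (freeDirac_isFormalAdjoint m)
    (μ * Complex.I) f
  have h4 : (μ * Complex.I).im = μ := by simp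
  rw [h4] at h3
  change |μ| * ‖(f : SpinorL2)‖ ≤ ‖freeDiracSub m (μ * Complex.I) f‖ at h3
  nlinarith [mul_le_mul_of_nonneg_right hKμ (norm_nonneg (f : SpinorL2)),
    norm_nonneg (f : SpinorL2)]

theorem exists_magneticDirac_sub_eq (m : ℝ) {μ : ℝ} (hμ : μ ≠ 0)
    (hbound : ∀ f : sobolevH1,
      ‖potentialOnH1 hA f‖ ≤ 1 / 2 * ‖freeDiracSub m (μ * Complex.I) f‖) (y : SpinorL2) :
    ∃ x : (magneticDirac m A).domain,
      magneticDirac m A x - (μ * Complex.I) • (x : SpinorL2) = y := by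
  obtain ⟨f, hf⟩ := exists_sub_eq_of_norm_le_mul_norm (freeDiracSub_bijective m hμ)
    (by norm_num) hbound y
  refine ⟨⟨f, f.2, sobolevH1_le_magneticPotential_domain hA f.2⟩, ?_⟩
  have h1 : magneticDirac m A ⟨f, f.2, sobolevH1_le_magneticPotential_domain hA f.2⟩ =
      freeDirac m f - potentialOnH1 hA f := rfl
  have h2 := freeDiracSub_apply m (μ * Complex.I) f
  rw [h1, ← hf, h2]
  exact sub_right_comm _ _ _

theorem magneticDirac_isSelfAdjoint {A : Fin 3 → Space3 → ℝ}
    (hA : ∀ j, MemLp (A j) 3 (volume : Measure Space3)) (m : ℝ) :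
    IsSelfAdjoint (magneticDirac m A) := by
  obtain ⟨μ, hμ, hbound⟩ := exists_norm_potentialOnH1_le_half_mul_norm hA m
  have h₁ := exists_magneticDirac_sub_eq hA m hμ.ne' (hbound μ (le_abs_self μ))
  have h₂ := exists_magneticDirac_sub_eq hA m (neg_ne_zero.mpr hμ.ne')
    (hbound (-μ) (by rw [abs_neg]; exact le_abs_self μ))
  refine isSelfAdjoint_of_isFormalAdjoint_of_surjective (magneticDirac_isFormalAdjoint hA m)
    hμ.ne' h₁ fun y => ?_
  obtain ⟨x, hx⟩ := h₂ y
  refine ⟨x, ?_⟩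
  rw [← hx, Complex.ofReal_neg, neg_mul]

end Potential

/-! ### Supersymmetry: $\beta$ anticommutes with $\alpha\cdot(D-A)$, and the gap $(-m,m)$. -/

section SpectralGap

open FourierTransform Filter Topology
open scoped InnerProductSpace

theorem compLpL_mem_sobolevH1 (L : Spinor →L[ℂ] Spinor) {f : SpinorL2} (hf : f ∈ sobolevH1) :
    L.compLpL 2 volume f ∈ sobolevH1 := by
  obtain ⟨w, hw⟩ := (memSobolev_one_iff_exists_ae_eq f).mp hf
  refine (memSobolev_one_iff_exists_ae_eq _).mpr ⟨L.compLpL 2 volume w, ?_⟩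
  rw [fourier_compLpL]
  filter_upwards [hw, L.coeFn_compLpL w, L.coeFn_compLpL (𝓕 f)] with ξ h1 h2 h3
  rw [h2, h3, h1, map_smul]

theorem weakPartial_compLpL (j : Fin 3) (L : Spinor →L[ℂ] Spinor) (f : sobolevH1) :
    weakPartial j ⟨L.compLpL 2 volume (f : SpinorL2), compLpL_mem_sobolevH1 L f.2⟩ =
      L.compLpL 2 volume (weakPartial j f) := by
  apply toTemperedDistribution_inj
  rw [← weakPartial_spec]
  ext1 u
  rw [TemperedDistribution.lineDerivOp_apply_apply, toTemperedDistribution_compLpL_apply,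
    toTemperedDistribution_compLpL_apply, ← weakPartial_spec,
    TemperedDistribution.lineDerivOp_apply_apply]

theorem compLpL_compLpL (L M : Spinor →L[ℂ] Spinor) (f : SpinorL2) :
    L.compLpL 2 volume (M.compLpL 2 volume f) = (L * M).compLpL 2 volume f := by
  apply Lp.ext
  filter_upwards [L.coeFn_compLpL (M.compLpL 2 volume f), M.coeFn_compLpL f,
    (L * M).coeFn_compLpL f] with x h1 h2 h3
  rw [h1, h2, h3]
  rfl

theorem compLpL_neg (L : Spinor →L[ℂ] Spinor) (f : SpinorL2) :
    (-L).compLpL 2 volume f = -L.compLpL 2 volume f := by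
  apply Lp.ext
  filter_upwards [L.coeFn_compLpL f, (-L).coeFn_compLpL f, Lp.coeFn_neg (L.compLpL 2 volume f)]
    with x h1 h2 h3
  rw [h2, h3, Pi.neg_apply, h1]
  rfl

theorem inner_compLpL_left {L : Spinor →L[ℂ] Spinor} (hL : IsSelfAdjoint L) (f g : SpinorL2) :
    ⟪L.compLpL 2 volume f, g⟫_ℂ = ⟪f, L.compLpL 2 volume g⟫_ℂ := by
  rw [L2.inner_def, L2.inner_def]
  refine integral_congr_ae ?_
  filter_upwards [L.coeFn_compLpL f, L.coeFn_compLpL g] with x h1 h2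
  rw [h1, h2, inner_apply_left_of_isSelfAdjoint hL]

theorem norm_compLpL_diracBeta (f : SpinorL2) : ‖diracBeta.compLpL 2 volume f‖ = ‖f‖ := by
  rw [Lp.norm_def, Lp.norm_def]
  congr 1
  refine eLpNorm_congr_norm_ae ?_
  filter_upwards [diracBeta.coeFn_compLpL f] with x h
  rw [h, norm_diracBeta_apply]

/-- Multiplication by `β` on `[H¹]⁴`. -/
noncomputable def betaH1 (f : sobolevH1) : sobolevH1 :=
  ⟨diracBeta.compLpL 2 volume (f : SpinorL2), compLpL_mem_sobolevH1 diracBeta f.2⟩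

/-- The constant matrix $\beta$ commutes with derivatives and anticommutes with each $\alpha_j$;
mass zero removes the term $m\beta$, which would commute with $\beta$. -/
theorem freeDirac_zero_betaH1 (f : sobolevH1) :
    freeDirac 0 (betaH1 f) = -diracBeta.compLpL 2 volume (freeDirac 0 f) := by
  rw [freeDirac_apply, freeDirac_apply]
  simp only [Complex.ofReal_zero, zero_smul, add_zero, map_sum, ← Finset.sum_neg_distrib]
  refine Finset.sum_congr rfl fun j _ => ?_
  rw [betaH1, weakPartial_compLpL, map_smul, compLpL_compLpL, compLpL_compLpL,
    diracAlpha_mul_diracBeta, compLpL_neg, smul_neg]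

variable {A : Fin 3 → Space3 → ℝ} (hA : ∀ j, MemLp (A j) 3 (volume : Measure Space3))

theorem potentialOnH1_betaH1 (f : sobolevH1) :
    potentialOnH1 hA (betaH1 f) = -diracBeta.compLpL 2 volume (potentialOnH1 hA f) := by
  apply Lp.ext
  filter_upwards [coeFn_potentialOnH1 hA (betaH1 f), coeFn_potentialOnH1 hA f,
    Lp.coeFn_neg (diracBeta.compLpL 2 volume (potentialOnH1 hA f)),
    diracBeta.coeFn_compLpL (potentialOnH1 hA f), diracBeta.coeFn_compLpL (f : SpinorL2)]
    with x h1 h2 h3 h4 h5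
  rw [h1, h3, Pi.neg_apply, h4, h2, alphaDotMul, alphaDotMul, map_sum, ← Finset.sum_neg_distrib]
  refine Finset.sum_congr rfl fun j _ => ?_
  change (A j x : ℂ) • diracAlpha j ((diracBeta.compLpL 2 volume (f : SpinorL2)) x) = _
  rw [h5, map_smul, ← mul_apply_eq_comp, ← mul_apply_eq_comp, diracAlpha_mul_diracBeta,
    neg_apply, smul_neg]

/-- With $Q$ symmetric and $Q\beta=-\beta Q$, $\langle Qf,\beta f\rangle=\langle f,Q\beta
f\rangle=-\langle\beta f,Qf\rangle$, so this number is minus its own conjugate. -/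
theorem re_inner_freeDirac_sub_potentialOnH1_betaH1 (f : sobolevH1) :
    (⟪freeDirac 0 f - potentialOnH1 hA f, diracBeta.compLpL 2 volume (f : SpinorL2)⟫_ℂ).re = 0 := by
  set q : SpinorL2 := freeDirac 0 f - potentialOnH1 hA f with hq
  set b : SpinorL2 := diracBeta.compLpL 2 volume (f : SpinorL2)
  have h1 : ⟪q, b⟫_ℂ = ⟪(f : SpinorL2), freeDirac 0 (betaH1 f) - potentialOnH1 hA (betaH1 f)⟫_ℂ := by
    rw [hq, inner_sub_left, inner_sub_right]
    congr 1
    · exact freeDirac_isFormalAdjoint 0 f (betaH1 f)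
    · exact inner_potentialOnH1_left hA f (betaH1 f)
  have h2 : freeDirac 0 (betaH1 f) - potentialOnH1 hA (betaH1 f) =
      -diracBeta.compLpL 2 volume q := by
    rw [freeDirac_zero_betaH1, potentialOnH1_betaH1, hq, map_sub]
    abel
  have h4 : ⟪(f : SpinorL2), diracBeta.compLpL 2 volume q⟫_ℂ = starRingEnd ℂ ⟪q, b⟫_ℂ := by
    rw [inner_conj_symm]
    exact (inner_compLpL_left diracBeta_isSelfAdjoint _ _).symm
  rw [h2, inner_neg_right, h4] at h1
  have h3 := congrArg Complex.re h1
  rw [Complex.neg_re, Complex.conj_re] at h3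
  linarith

theorem freeDirac_eq_freeDirac_zero_add (m : ℝ) (f : sobolevH1) :
    freeDirac m f = freeDirac 0 f + (m : ℂ) • diracBeta.compLpL 2 volume (f : SpinorL2) := by
  rw [freeDirac_apply, freeDirac_apply, Complex.ofReal_zero, zero_smul, add_zero]

/-- The supersymmetric structure `H_A² = Q² + m²` gives `m ‖f‖ ≤ ‖H_A f‖`. -/
theorem mul_norm_le_norm_freeDirac_sub_potentialOnH1 {m : ℝ} (hm : 0 ≤ m) (f : sobolevH1) :
    m * ‖(f : SpinorL2)‖ ≤ ‖freeDirac m f - potentialOnH1 hA f‖ := by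
  have h1 : freeDirac m f - potentialOnH1 hA f = (freeDirac 0 f - potentialOnH1 hA f) +
      (m : ℂ) • diracBeta.compLpL 2 volume (f : SpinorL2) := by
    rw [freeDirac_eq_freeDirac_zero_add]; abel
  have h2 : ‖freeDirac m f - potentialOnH1 hA f‖ ^ 2 =
      ‖freeDirac 0 f - potentialOnH1 hA f‖ ^ 2 + (m * ‖(f : SpinorL2)‖) ^ 2 := by
    rw [h1, @norm_add_sq ℂ, inner_smul_right, norm_smul, norm_compLpL_diracBeta,
      Complex.norm_real, Real.norm_of_nonneg hm]
    have h3 := re_inner_freeDirac_sub_potentialOnH1_betaH1 hA f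
    have h4 : RCLike.re ((m : ℂ) * ⟪freeDirac 0 f - potentialOnH1 hA f,
        diracBeta.compLpL 2 volume (f : SpinorL2)⟫_ℂ) = 0 := by
      rw [RCLike.re_eq_complex_re, Complex.re_ofReal_mul, h3, mul_zero]
    rw [h4, mul_zero, add_zero]
  refine le_of_sq_le_sq ?_ (norm_nonneg _)
  rw [h2]
  exact le_add_of_nonneg_left (sq_nonneg _)

theorem mem_unboundedResolventSet_magneticDirac_of_im_ne_zero {A : Fin 3 → Space3 → ℝ}
    (hA : ∀ j, MemLp (A j) 3 (volume : Measure Space3)) (m : ℝ) {z : ℂ} (hz : z.im ≠ 0) :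
    z ∈ unboundedResolventSet (magneticDirac m A) := by
  have h := magneticDirac_isFormalAdjoint hA m
  refine mem_unboundedResolventSet_of_isSelfAdjoint (magneticDirac_isSelfAdjoint hA m)
    (abs_pos.mpr hz) (abs_im_mul_norm_le_of_isFormalAdjoint h z) fun x => ?_
  simpa using abs_im_mul_norm_le_of_isFormalAdjoint h (starRingEnd ℂ z) x

/-- From $\|H_Af\|\ge m\|f\|$ the triangle inequality leaves the lower bound $m-|t|>0$ for $H_A-t$.
-/
theorem mem_unboundedResolventSet_magneticDirac_of_abs_lt {A : Fin 3 → Space3 → ℝ}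
    (hA : ∀ j, MemLp (A j) 3 (volume : Measure Space3)) {m t : ℝ} (ht : |t| < m) :
    (t : ℂ) ∈ unboundedResolventSet (magneticDirac m A) := by
  have h : ∀ x : (magneticDirac m A).domain,
      (m - |t|) * ‖(x : SpinorL2)‖ ≤ ‖magneticDirac m A x - (t : ℂ) • (x : SpinorL2)‖ := by
    intro x
    have h1 : m * ‖(x : SpinorL2)‖ ≤ ‖magneticDirac m A x‖ :=
      mul_norm_le_norm_freeDirac_sub_potentialOnH1 hA ((abs_nonneg t).trans ht.le) ⟨x, x.2.1⟩
    have h2 := norm_sub_norm_le (magneticDirac m A x) ((t : ℂ) • (x : SpinorL2))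
    rw [norm_smul, Complex.norm_real, Real.norm_eq_abs] at h2
    linarith
  refine mem_unboundedResolventSet_of_isSelfAdjoint (magneticDirac_isSelfAdjoint hA m)
    (sub_pos.mpr ht) h ?_
  rwa [Complex.conj_ofReal]

end SpectralGap

/-! ### Modulated trial functions, dilation, and the resulting spectrum. -/

section EssentialSpectrum

open Filter Topology
open scoped ContDiff InnerProductSpace

theorem diracBeta_mul_diracSymbol_add (m : ℝ) (p : Fin 3 → ℝ) :
    diracSymbol m p * diracBeta + diracBeta * diracSymbol m p = (2 * m : ℂ) • 1 := by
  simp only [diracSymbol, Fin.sum_univ_three, add_mul, mul_add, smul_mul_assoc, mul_smul_comm,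
    diracBeta_mul_self, diracAlpha_mul_diracBeta]
  module

/-- Every real number `t` with `|t| ≥ m` is an eigenvalue of the Dirac symbol at some momentum. -/
theorem exists_diracSymbol_apply_eq {m t : ℝ} (hm : 0 < m) (ht : m ≤ |t|) :
    ∃ (p : Fin 3 → ℝ) (u : Spinor), u ≠ 0 ∧ diracSymbol m p u = (t : ℂ) • u := by
  have ht0 : t ≠ 0 := abs_pos.mp (hm.trans_le ht)
  have hsq : m ^ 2 ≤ t ^ 2 := by
    rw [← sq_abs t]; gcongr
  -- The length of $p$ is fixed by $|p|^2+m^2=t^2$, the direction is arbitrary. Then $P^2=t^2$, so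
  -- $(P-t)(P+t)=0$ and any nonzero vector $(P+t)v$ is an eigenvector.
  let p : Fin 3 → ℝ := ![0, 0, Real.sqrt (t ^ 2 - m ^ 2)]
  have hp : ∑ j, p j ^ 2 + m ^ 2 = t ^ 2 := by
    simp [p, Fin.sum_univ_three, Real.sq_sqrt (sub_nonneg.mpr hsq)]
  set P := diracSymbol m p with hPdef
  have hPP : ∀ v, P (P v) = (t ^ 2 : ℂ) • v := fun v => by
    rw [← mul_apply_eq_comp, hPdef, diracSymbol_mul_self, hp]
    simp
  by_cases h : ∃ v, P v + (t : ℂ) • v ≠ 0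
  · obtain ⟨v, hv⟩ := h
    refine ⟨p, P v + (t : ℂ) • v, hv, ?_⟩
    rw [map_add, map_smul, hPP, smul_add, smul_smul, sq, add_comm]
  -- Otherwise $P=-t$ identically. The relation $P\beta+\beta P=2m$ then makes $\beta$ the nonzero
  -- scalar $-m/t$, which cannot anticommute with the invertible $\alpha_1$.
  · push Not at h
    have hP : ∀ v, P v = -((t : ℂ) • v) := fun v => eq_neg_of_add_eq_zero_left (h v)
    have htc : (t : ℂ) ≠ 0 := Complex.ofReal_ne_zero.mpr ht0
    have hmc : (m : ℂ) ≠ 0 := Complex.ofReal_ne_zero.mpr hm.ne'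
    have hβ : ∀ v, diracBeta v = (-(m / t) : ℂ) • v := by
      intro v
      have h1 := DFunLike.congr_fun (diracBeta_mul_diracSymbol_add m p) v
      rw [add_apply, mul_apply_eq_comp, mul_apply_eq_comp, ← hPdef, hP, hP, map_neg, map_smul] at h1
      have h2 : (-(2 * t) : ℂ) • diracBeta v = (2 * m : ℂ) • v := by
        have h3 : ((2 * m : ℂ) • (1 : Spinor →L[ℂ] Spinor)) v = (2 * m : ℂ) • v := rfl
        rw [← h3, ← h1]
        module
      rw [← inv_smul_smul₀ (neg_ne_zero.mpr (mul_ne_zero two_ne_zero htc)) (diracBeta v), h2,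
        smul_smul]
      congr 1
      field_simp
    exfalso
    obtain ⟨v, hv⟩ := exists_ne (0 : Spinor)
    have h1 := DFunLike.congr_fun (diracAlpha_mul_diracBeta 0) v
    rw [neg_apply, mul_apply_eq_comp, mul_apply_eq_comp, hβ, hβ, map_smul, eq_neg_iff_add_eq_zero,
      ← add_smul, smul_eq_zero] at h1
    rcases h1 with h1 | h1
    · rw [← two_mul, mul_neg, neg_eq_zero] at h1
      exact mul_ne_zero two_ne_zero (div_ne_zero hmc htc) h1
    · exact hv (norm_eq_zero.mp (by rw [← norm_diracAlpha_apply 0 v, h1, norm_zero]))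

theorem schwartz_toLp_mem_sobolevH1 (φ : 𝓢(Space3, Spinor)) :
    φ.toLp 2 volume ∈ sobolevH1 := by
  have h := φ.memSobolev (s := 1) (p := 2)
  rw [← Lp.toTemperedDistribution_toLp_eq (p := 2)] at h
  exact h

theorem weakPartial_schwartz (j : Fin 3) (φ : 𝓢(Space3, Spinor)) :
    weakPartial j ⟨φ.toLp 2 volume, schwartz_toLp_mem_sobolevH1 φ⟩ =
      (∂_{EuclideanSpace.single j (1 : ℝ)} φ : 𝓢(Space3, Spinor)).toLp 2 volume := by
  apply toTemperedDistribution_inj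
  rw [← weakPartial_spec]
  simp only [Lp.toTemperedDistribution_toLp_eq,
    TemperedDistribution.lineDerivOp_toTemperedDistributionCLM_eq]

/-- A compactly supported smooth amplitude times a constant spinor. -/
theorem exists_schwartz_eq_smul_const (u : Spinor) {ρ : Space3 → ℝ}
    (hρ : ContDiff ℝ ∞ ρ) (hρc : HasCompactSupport ρ) :
    ∃ g : 𝓢(Space3, Spinor), (∀ x, g x = ρ x • u) ∧ HasCompactSupport g ∧
      ∀ (v x : Space3), (∂_{v} g : 𝓢(Space3, Spinor)) x = fderiv ℝ ρ x v • u := by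
  have hg : ContDiff ℝ ∞ fun x => ρ x • u := hρ.smul contDiff_const
  have hgc : HasCompactSupport fun x => ρ x • u := hρc.smul_right
  refine ⟨hgc.toSchwartzMap hg, fun _ => rfl, hgc, fun v x => ?_⟩
  have hgd : HasFDerivAt (fun x => ρ x • u) ((fderiv ℝ ρ x).smulRight u) x :=
    ((hρ.differentiable (by simp)) x).hasFDerivAt.smul_const u
  rw [SchwartzMap.lineDerivOp_apply_eq_fderiv]
  change fderiv ℝ (fun x => ρ x • u) x v = _
  rw [hgd.fderiv, ContinuousLinearMap.smulRight_apply]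

/-- Multiplication of a compactly supported Schwartz function with a plane wave. -/
theorem exists_modulated_schwartz (θ : Space3 →L[ℝ] ℝ) (g : 𝓢(Space3, Spinor))
    (hgc : HasCompactSupport g) :
    ∃ (e : Space3 → ℂ) (f : 𝓢(Space3, Spinor)), (∀ x, ‖e x‖ = 1) ∧ (∀ x, f x = e x • g x) ∧
      ∀ (v x : Space3), (∂_{v} f : 𝓢(Space3, Spinor)) x =
        e x • ((∂_{v} g : 𝓢(Space3, Spinor)) x + (Complex.I * θ v) • g x) := by
  let e : Space3 → ℂ := fun x => Complex.exp (Complex.I * (θ x : ℂ))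
  have he : ContDiff ℝ ∞ e := by
    refine ContDiff.cexp (contDiff_const.mul ?_)
    exact Complex.ofRealCLM.contDiff.comp θ.contDiff
  have hf : ContDiff ℝ ∞ (e • ⇑g) := he.smul (g.smooth ⊤)
  have hfc : HasCompactSupport (e • ⇑g) := hgc.smul_left
  refine ⟨e, hfc.toSchwartzMap hf, fun x => ?_, fun _ => rfl, fun v x => ?_⟩
  · rw [← Complex.norm_exp_ofReal_mul_I (θ x), mul_comm]
  · have hed : HasFDerivAt e (e x • (Complex.I • (Complex.ofRealCLM.comp θ))) x :=
      (((Complex.ofRealCLM.comp θ).hasFDerivAt (x := x)).const_mul Complex.I).cexp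
    have hfd := (hed.smul (g.differentiableAt (x := x)).hasFDerivAt).fderiv
    rw [SchwartzMap.lineDerivOp_apply_eq_fderiv, SchwartzMap.lineDerivOp_apply_eq_fderiv]
    change fderiv ℝ (e • ⇑g) x v = _
    rw [hfd, add_apply, ContinuousLinearMap.smulRight_apply, smul_add, smul_smul (e x) (Complex.I * _)]
    congr 2

/-- A unimodular factor commutes with pointwise matrices. This allows the gradient bound to be
applied to the envelope `g` instead of the oscillating `f`, whose gradient does not become small. -/
theorem norm_potentialOnH1_eq_of_ae_eq_smul {A : Fin 3 → Space3 → ℝ}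
    (hA : ∀ j, MemLp (A j) 3 (volume : Measure Space3)) {f g : sobolevH1} {e : Space3 → ℂ}
    (he : ∀ x, ‖e x‖ = 1)
    (h : (f : SpinorL2) =ᵐ[volume] fun x => e x • (g : SpinorL2) x) :
    ‖potentialOnH1 hA f‖ = ‖potentialOnH1 hA g‖ := by
  rw [norm_potentialOnH1, norm_potentialOnH1]
  congr 1
  refine eLpNorm_congr_norm_ae ?_
  filter_upwards [h] with x hx
  have h3 : alphaDotMul A (f : SpinorL2) x = e x • alphaDotMul A (g : SpinorL2) x := by
    simp only [alphaDotMul, hx, map_smul, Finset.smul_sum]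
    exact Finset.sum_congr rfl fun j _ => smul_comm _ _ _
  rw [h3, norm_smul, he, one_mul]

theorem norm_le_sum_norm_of_ae_le {E F : Type*} [MeasurableSpace E] {μ : Measure E}
    [NormedAddCommGroup F] {ι : Type*} [Fintype ι] {f : Lp F 2 μ} {g : ι → Lp F 2 μ}
    (h : ∀ᵐ x ∂μ, ‖f x‖ ≤ ∑ j, ‖g j x‖) : ‖f‖ ≤ ∑ j, ‖g j‖ := by
  rw [Lp.norm_def]
  refine ENNReal.toReal_le_of_le_ofReal (Finset.sum_nonneg fun _ _ => norm_nonneg _) ?_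
  refine (eLpNorm_mono_ae_real (g := ∑ j, fun x => ‖g j x‖) ?_).trans ?_
  · filter_upwards [h] with x hx
    rwa [Finset.sum_apply]
  refine (eLpNorm_sum_le (fun j _ => (Lp.aestronglyMeasurable (g j)).norm)
    one_le_two).trans_eq ?_
  rw [ENNReal.ofReal_sum_of_nonneg (fun _ _ => norm_nonneg _)]
  refine Finset.sum_congr rfl fun j _ => ?_
  rw [eLpNorm_norm, Lp.norm_def, ENNReal.ofReal_toReal (Lp.eLpNorm_ne_top _)]

/-- The free Dirac operator on a modulated spinor in an eigenspace of the symbol. -/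
theorem norm_freeDirac_sub_le_of_ae_eq_smul {m t : ℝ} {p : Fin 3 → ℝ} {f g : sobolevH1}
    {e : Space3 → ℂ} (he : ∀ x, ‖e x‖ = 1)
    (hf : (f : SpinorL2) =ᵐ[volume] fun x => e x • (g : SpinorL2) x)
    (hfd : ∀ j, weakPartial j f =ᵐ[volume] fun x =>
      e x • (weakPartial j g x + (Complex.I * p j) • (g : SpinorL2) x))
    (hg : ∀ᵐ x, diracSymbol m p ((g : SpinorL2) x) = (t : ℂ) • (g : SpinorL2) x) :
    ‖freeDirac m f - (t : ℂ) • (f : SpinorL2)‖ ≤ ∑ j, ‖weakPartial j g‖ := by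
  refine norm_le_sum_norm_of_ae_le ?_
  rw [freeDirac_apply]
  filter_upwards [Lp.coeFn_sub (∑ j : Fin 3, (-Complex.I) •
      (diracAlpha j).compLpL 2 volume (weakPartial j f) +
      (m : ℂ) • diracBeta.compLpL 2 volume (f : SpinorL2)) ((t : ℂ) • (f : SpinorL2)),
    Lp.coeFn_smul (t : ℂ) (f : SpinorL2),
    coeFn_sum_smul_compLpL_add (fun _ => -Complex.I) m diracAlpha diracBeta
      (fun j => weakPartial j f) (f : SpinorL2), hf, ae_all_iff.mpr hfd, hg]
    with x h2 h3 h4 h8 h7 h9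
  rw [h2, Pi.sub_apply, h3, Pi.smul_apply, h4]
  generalize (g : SpinorL2) x = G at *
  -- Differentiating the phase produces $\alpha_jp_j$. Summed and combined with $m\beta-t$, these
  -- terms cancel by the eigenvalue equation, leaving only derivatives of the envelope.
  have h11 : ∀ j, (-Complex.I) • diracAlpha j (weakPartial j f x) =
      (-Complex.I * e x) • diracAlpha j (weakPartial j g x) +
        e x • (p j : ℂ) • diracAlpha j G := fun j => by
    rw [h7, map_smul, map_add, map_smul, smul_add, smul_add, smul_smul, smul_smul, smul_smul,
      smul_smul]
    congr 2
    linear_combination (-(e x * p j)) * Complex.I_mul_I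
  have h10 : (∑ j, (-Complex.I) • diracAlpha j (weakPartial j f x) +
      (m : ℂ) • diracBeta ((f : SpinorL2) x)) - (t : ℂ) • (f : SpinorL2) x =
      ∑ j, (-Complex.I * e x) • diracAlpha j (weakPartial j g x) := by
    simp only [h11, Finset.sum_add_distrib, ← Finset.smul_sum]
    rw [h8, map_smul, smul_comm (t : ℂ), ← h9, diracSymbol_apply, smul_add,
      smul_comm (m : ℂ) (e x)]
    abel
  rw [h10]
  refine (norm_sum_le _ _).trans_eq (Finset.sum_congr rfl fun j _ => ?_)
  rw [norm_smul, norm_mul, norm_neg, Complex.norm_I, he, one_mul, one_mul,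
    norm_diracAlpha_apply]

theorem exists_norm_le_of_mem_unboundedResolventSet_magneticDirac {A : Fin 3 → Space3 → ℝ}
    (hA : ∀ j, MemLp (A j) 3 (volume : Measure Space3)) {m : ℝ} {z : ℂ}
    (hz : z ∈ unboundedResolventSet (magneticDirac m A)) :
    ∃ C : ℝ, 0 ≤ C ∧ ∀ f : sobolevH1,
      ‖(f : SpinorL2)‖ ≤ C * (‖freeDirac m f - z • (f : SpinorL2)‖ + ‖potentialOnH1 hA f‖) := by
  obtain ⟨C, hC⟩ := exists_pos_mul_norm_le_of_mem_unboundedResolventSet hz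
  refine ⟨|C|, abs_nonneg C, fun f => ?_⟩
  have h1 : magneticDirac m A ⟨f, f.2, sobolevH1_le_magneticPotential_domain hA f.2⟩ =
      freeDirac m f - potentialOnH1 hA f := rfl
  have h2 := hC ⟨f, f.2, sobolevH1_le_magneticPotential_domain hA f.2⟩
  rw [h1] at h2
  have h3 : freeDirac m f - potentialOnH1 hA f - z • (f : SpinorL2) =
      (freeDirac m f - z • (f : SpinorL2)) - potentialOnH1 hA f := sub_right_comm _ _ _
  calc ‖(f : SpinorL2)‖ ≤ C * ‖freeDirac m f - potentialOnH1 hA f - z • (f : SpinorL2)‖ := h2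
    _ ≤ |C| * ‖freeDirac m f - potentialOnH1 hA f - z • (f : SpinorL2)‖ := by
        gcongr; exact le_abs_self C
    _ ≤ _ := by
        rw [h3]
        gcongr
        exact norm_sub_le _ _

/-- If `t` is in the resolvent set of `H_A` and an eigenvalue of the symbol, then the Poincaré
inequality holds on the whole space. -/
theorem exists_norm_le_sum_fderiv_of_mem_resolventSet {A : Fin 3 → Space3 → ℝ}
    (hA : ∀ j, MemLp (A j) 3 (volume : Measure Space3)) {m t : ℝ} {p : Fin 3 → ℝ} {u : Spinor}
    (hu : diracSymbol m p u = (t : ℂ) • u)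
    (ht : (t : ℂ) ∈ unboundedResolventSet (magneticDirac m A)) :
    ∃ C : ℝ, ∀ ρ : Space3 → ℝ, ContDiff ℝ ∞ ρ → HasCompactSupport ρ →
      (eLpNorm (fun x => ρ x • u) 2 volume).toReal ≤ C * ∑ j, (eLpNorm (fun x =>
        fderiv ℝ ρ x (EuclideanSpace.single j (1 : ℝ)) • u) 2 volume).toReal := by
  obtain ⟨C, hC0, hC⟩ := exists_norm_le_of_mem_unboundedResolventSet_magneticDirac hA ht
  obtain ⟨K, hK⟩ := exists_norm_potentialOnH1_le_mul_sum_weakPartial hA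
  refine ⟨C * (1 + K), fun ρ hρ hρc => ?_⟩
  obtain ⟨g, hg, hgc, hgd⟩ := exists_schwartz_eq_smul_const u hρ hρc
  -- $\theta(x)=p\cdot x$, the phase of the plane wave.
  let θ : Space3 →L[ℝ] ℝ := ∑ i, p i • EuclideanSpace.proj i
  have hθ : ∀ j, θ (EuclideanSpace.single j (1 : ℝ)) = p j := fun j => by
    simp [θ]
  obtain ⟨e, f, he, hf, hfd⟩ := exists_modulated_schwartz θ g hgc
  let F : sobolevH1 := ⟨f.toLp 2 volume, schwartz_toLp_mem_sobolevH1 f⟩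
  let G : sobolevH1 := ⟨g.toLp 2 volume, schwartz_toLp_mem_sobolevH1 g⟩
  have hFG : (F : SpinorL2) =ᵐ[volume] fun x => e x • (G : SpinorL2) x := by
    filter_upwards [f.coeFn_toLp 2 volume, g.coeFn_toLp 2 volume] with x h1 h2
    exact h1.trans ((hf x).trans (congrArg _ h2.symm))
  have hFGd : ∀ j, weakPartial j F =ᵐ[volume] fun x =>
      e x • (weakPartial j G x + (Complex.I * p j) • (G : SpinorL2) x) := fun j => by
    rw [weakPartial_schwartz, weakPartial_schwartz]
    filter_upwards [g.coeFn_toLp 2 volume, SchwartzMap.coeFn_toLp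
      (∂_{EuclideanSpace.single j (1 : ℝ)} f : 𝓢(Space3, Spinor)) 2 volume, SchwartzMap.coeFn_toLp
      (∂_{EuclideanSpace.single j (1 : ℝ)} g : 𝓢(Space3, Spinor)) 2 volume] with x h1 h2 h3
    rw [h2, h3, hfd, hθ, h1]
  have hGs : ∀ᵐ x, diracSymbol m p ((G : SpinorL2) x) = (t : ℂ) • (G : SpinorL2) x := by
    filter_upwards [g.coeFn_toLp 2 volume] with x h1
    rw [h1, hg, ← Complex.coe_smul, map_smul, hu, smul_comm]
  have hG : ∀ j, (eLpNorm (fun x => fderiv ℝ ρ x (EuclideanSpace.single j (1 : ℝ)) • u) 2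
      volume).toReal = ‖weakPartial j G‖ := fun j => by
    rw [weakPartial_schwartz, SchwartzMap.norm_toLp]
    congr 2
    funext x
    exact (hgd _ x).symm
  have hFnorm : (eLpNorm (fun x => ρ x • u) 2 volume).toReal = ‖(F : SpinorL2)‖ := by
    refine Eq.trans ?_ (SchwartzMap.norm_toLp (f := f) (p := 2) (μ := volume)).symm
    congr 1
    refine eLpNorm_congr_norm_ae (Eventually.of_forall fun x => ?_)
    rw [hf, norm_smul (e x), he, one_mul, hg]
  simp only [hG, hFnorm]
  calc ‖(F : SpinorL2)‖ ≤ C * (‖freeDirac m F - (t : ℂ) • (F : SpinorL2)‖ +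
        ‖potentialOnH1 hA F‖) := hC F
    _ ≤ C * (∑ j, ‖weakPartial j G‖ + K * ∑ j, ‖weakPartial j G‖) := by
        gcongr
        · exact norm_freeDirac_sub_le_of_ae_eq_smul he hFG hFGd hGs
        · exact (norm_potentialOnH1_eq_of_ae_eq_smul hA he hFG).trans_le (hK G)
    _ = _ := by ring

/-- The factor `s` is the same for all `h`, so it cancels from an inequality between norms; only its
positivity is needed. -/
theorem toReal_eLpNorm_comp_smul {E F : Type*} [NormedAddCommGroup E] [NormedSpace ℝ E]
    [FiniteDimensional ℝ E] [MeasurableSpace E] [BorelSpace E] (μ : Measure E)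
    [μ.IsAddHaarMeasure] [NormedAddCommGroup F] {c : ℝ} (hc : c ≠ 0) {p : ENNReal} (hp : p ≠ ⊤) :
    ∃ s : ℝ, 0 < s ∧ ∀ h : E → F, Continuous h →
      (eLpNorm (fun x => h (c • x)) p μ).toReal = s * (eLpNorm h p μ).toReal := by
  have hpos : 0 < |(c ^ Module.finrank ℝ E)⁻¹| := by positivity
  refine ⟨(ENNReal.ofReal |(c ^ Module.finrank ℝ E)⁻¹| ^ (1 / p).toReal).toReal, ?_, fun h hh => ?_⟩
  · refine ENNReal.toReal_pos ?_ ?_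
    · rw [ENNReal.ofReal_rpow_of_pos hpos, Ne, ENNReal.ofReal_eq_zero, not_le]
      positivity
    · exact ENNReal.rpow_ne_top_of_nonneg ENNReal.toReal_nonneg ENNReal.ofReal_ne_top
  · have hmap := Measure.map_addHaar_smul μ hc
    have h1 := eLpNorm_map_measure (p := p) (μ := μ) (f := (c • · : E → E))
      hh.aestronglyMeasurable (measurable_const_smul c).aemeasurable
    rw [hmap, eLpNorm_smul_measure_of_ne_top hp, smul_eq_mul] at h1
    change (eLpNorm (h ∘ (c • ·)) p μ).toReal = _
    rw [← h1, ENNReal.toReal_mul]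

/-- Every real number `t` with `|t| ≥ m` is in the spectrum of `H_A`. -/
theorem mem_unboundedSpectrum_magneticDirac {A : Fin 3 → Space3 → ℝ}
    (hA : ∀ j, MemLp (A j) 3 (volume : Measure Space3)) {m t : ℝ} (hm : 0 < m) (ht : m ≤ |t|) :
    (t : ℂ) ∈ unboundedSpectrum (magneticDirac m A) := by
  intro hres
  obtain ⟨p, u, hu0, hu⟩ := exists_diracSymbol_apply_eq hm ht
  obtain ⟨C, hC⟩ := exists_norm_le_sum_fderiv_of_mem_resolventSet hA hu hres
  let χ : ContDiffBump (0 : Space3) := ⟨1, 2, one_pos, one_lt_two⟩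
  have hχ : ContDiff ℝ ∞ χ := χ.contDiff
  have hcont : Continuous fun x => χ x • u := χ.continuous.smul continuous_const
  set N : ℝ := (eLpNorm (fun x => χ x • u) 2 volume).toReal with hN
  let S : ℝ := ∑ j, (eLpNorm (fun x =>
    fderiv ℝ χ x (EuclideanSpace.single j (1 : ℝ)) • u) 2 volume).toReal
  have hNpos : 0 < N := by
    have hmem : MemLp (fun x => χ x • u) 2 (volume : Measure Space3) :=
      hcont.memLp_of_hasCompactSupport χ.hasCompactSupport.smul_right
    refine ENNReal.toReal_pos ?_ hmem.eLpNorm_ne_top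
    rw [Ne, eLpNorm_eq_zero_iff hmem.1 two_ne_zero, hcont.ae_eq_iff_eq volume continuous_zero]
    intro h
    have h1 := congrFun h 0
    have h2 : χ 0 = 1 := χ.one_of_mem_closedBall (Metric.mem_closedBall_self χ.rIn_pos.le)
    rw [h2, one_smul] at h1
    exact hu0 h1
  -- For the envelope $\chi(cx)$ both sides carry the factor `s`, but the chain rule gives the
  -- gradient side an extra `c`. Letting $c\to0$ contradicts $N>0$.
  have hscale : ∀ c : ℝ, 0 < c → N ≤ C * (c * S) := by
    intro c hc
    obtain ⟨s, hs, hsc⟩ := toReal_eLpNorm_comp_smul (F := Spinor) (volume : Measure Space3) hc.ne'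
      (p := 2) ENNReal.ofNat_ne_top
    have h1 := hC (fun x => χ (c • x)) (hχ.comp (contDiff_const_smul c))
      (χ.hasCompactSupport.comp_smul hc.ne')
    have h2 : ∀ x, fderiv ℝ (fun x => χ (c • x)) x = c • fderiv ℝ χ (c • x) := by
      intro x
      have h3 : HasFDerivAt χ (fderiv ℝ χ (c • x)) (c • x) :=
        (hχ.differentiable (by simp) _).hasFDerivAt
      have h4 := (h3.comp x ((hasFDerivAt_id x).const_smul c)).fderiv
      rw [ContinuousLinearMap.comp_smul, ContinuousLinearMap.comp_id] at h4
      exact h4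
    have h5 : ∀ j : Fin 3, (eLpNorm (fun x => fderiv ℝ (fun x => χ (c • x)) x
        (EuclideanSpace.single j (1 : ℝ)) • u) 2 volume).toReal = s * (c * (eLpNorm (fun x =>
        fderiv ℝ χ x (EuclideanSpace.single j (1 : ℝ)) • u) 2 volume).toReal) := by
      intro j
      have hcd : Continuous fun x => fderiv ℝ χ x (EuclideanSpace.single j (1 : ℝ)) • u :=
        ((hχ.continuous_fderiv (by simp)).clm_apply continuous_const).smul continuous_const
      have h6 : (fun x => fderiv ℝ (fun x => χ (c • x)) x (EuclideanSpace.single j (1 : ℝ)) • u) =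
          c • fun x => fderiv ℝ χ (c • x) (EuclideanSpace.single j (1 : ℝ)) • u := by
        funext x
        rw [h2, smul_apply, Pi.smul_apply, smul_assoc]
      rw [h6, eLpNorm_const_smul, ENNReal.toReal_mul, hsc _ hcd, toReal_enorm,
        Real.norm_of_nonneg hc.le]
      ring
    simp only [h5, ← Finset.mul_sum] at h1
    rw [hsc _ hcont] at h1
    refine le_of_mul_le_mul_left (h1.trans_eq ?_) hs
    ring
  have hlim : Tendsto (fun c : ℝ => C * (c * S)) (𝓝[>] 0) (𝓝 0) := by
    have : Continuous fun c : ℝ => C * (c * S) := by fun_prop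
    simpa using (this.tendsto 0).mono_left nhdsWithin_le_nhds
  exact hNpos.not_ge (ge_of_tendsto hlim (eventually_mem_nhdsWithin.mono hscale))

theorem unboundedSpectrum_magneticDirac {A : Fin 3 → Space3 → ℝ}
    (hA : ∀ j, MemLp (A j) 3 (volume : Measure Space3)) {m : ℝ} (hm : 0 < m) :
    unboundedSpectrum (magneticDirac m A) =
      (fun t : ℝ => (t : ℂ)) '' (Set.Iic (-m) ∪ Set.Ici m) := by
  ext z
  constructor
  · intro hz
    have him : z.im = 0 := by
      by_contra h
      exact hz (mem_unboundedResolventSet_magneticDirac_of_im_ne_zero hA m h)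
    have hzre : (z.re : ℂ) = z := Complex.ext rfl (by simp [him])
    refine ⟨z.re, ?_, hzre⟩
    have hre : m ≤ |z.re| := by
      by_contra! h
      refine hz ?_
      rw [← hzre]
      exact mem_unboundedResolventSet_magneticDirac_of_abs_lt hA h
    rcases le_abs.mp hre with h | h
    · exact Or.inr h
    · exact Or.inl (Set.mem_Iic.mpr (by linarith))
  · rintro ⟨t, ht | ht, rfl⟩
    · exact mem_unboundedSpectrum_magneticDirac hA hm (le_abs.mpr (Or.inr (by
        rw [Set.mem_Iic] at ht; linarith)))
    · exact mem_unboundedSpectrum_magneticDirac hA hm (le_abs.mpr (Or.inl ht))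

/-- No point of `(-∞, -m] ∪ [m, ∞)` is isolated, hence the discrete spectrum is empty. -/
theorem discreteSpectrum_magneticDirac {A : Fin 3 → Space3 → ℝ}
    (hA : ∀ j, MemLp (A j) 3 (volume : Measure Space3)) {m : ℝ} (hm : 0 < m) :
    discreteSpectrum (magneticDirac m A) = ∅ := by
  rw [Set.eq_empty_iff_forall_notMem]
  rintro z ⟨hz, ⟨ε, hε, hiso⟩, -⟩
  rw [unboundedSpectrum_magneticDirac hA hm] at hz hiso
  obtain ⟨t, ht, rfl⟩ := hz
  have key : ∀ s : ℝ, |s| < ε → s ≠ 0 → t + s ∉ Set.Iic (-m) ∪ Set.Ici m := by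
    intro s hs hs0 hmem
    have h := hiso ((t + s : ℝ) : ℂ) ⟨t + s, hmem, rfl⟩ (by
      rw [dist_eq_norm, ← Complex.ofReal_sub, Complex.norm_real, add_sub_cancel_left]
      exact hs)
    rw [Complex.ofReal_inj] at h
    exact hs0 (by linarith)
  have habs : |ε / 2| < ε := by rw [abs_of_pos (by positivity)]; linarith
  -- Moving outward from the gap by $\varepsilon/2$ stays in the spectrum.
  rcases ht with ht | ht
  · refine key (-(ε / 2)) (by rwa [abs_neg]) (by linarith) (Or.inl ?_)
    rw [Set.mem_Iic] at ht ⊢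
    linarith
  · refine key (ε / 2) habs (by linarith) (Or.inr ?_)
    rw [Set.mem_Ici] at ht ⊢
    linarith

end EssentialSpectrum

theorem mainTheorem11 (m : ℝ) (hm : 0 < m) (A : Fin 3 → Space3 → ℝ)
    (hA : ∀ j, MemLp (A j) 3 (volume : Measure Space3)) :
    (magneticDirac m A).domain = sobolevH1 ∧
    IsSelfAdjoint (magneticDirac m A) ∧
    unboundedSpectrum (magneticDirac m A) = essentialSpectrum (magneticDirac m A) ∧
    essentialSpectrum (magneticDirac m A) =
      (fun t : ℝ => (t : ℂ)) '' (Set.Iic (-m) ∪ Set.Ici m) := by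
  have hess : essentialSpectrum (magneticDirac m A) = unboundedSpectrum (magneticDirac m A) := by
    rw [essentialSpectrum, discreteSpectrum_magneticDirac hA hm, Set.sdiff_empty]
  exact ⟨magneticDirac_domain m hA, magneticDirac_isSelfAdjoint hA m, hess.symm,
    hess.trans (unboundedSpectrum_magneticDirac hA hm)⟩
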